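/- Let $V$ be a finite set. Call a family $\mathfrak{B}$ of subsets of $V$ a \emph{mountain} if every member of $\mathfrak{B}$ has at least two elements and every subset with at least two elements of a member of $\mathfrak{B}$ again belongs to $\mathfrak{B}$ (the empty family is allowed). For $x\in V$ let $d_{\mathfrak{B}}(x)=|\{F\in\mathfrak{B}: x\in F\}|$. Let $d,m$ be integers with $d\ge 4$ and $d\ge m\ge 3$, let $\mathfrak{B}_1,\dots,\mathfrak{B}_t$ be mountains on $V$, and let $f\colon V\to\mathbb{N}_0$ be a function such that $$f(x)+\sum_{\tau=1}^{t}d_{\mathfrak{B}_\tau}(x)\ \ge\ 2^d-m\qquad\text{for every }x\in V.$$ Assume moreover that $|F|<d$ for every $F\in\mathfrak{B}_2\cup\dots\cup\mathfrak{B}_t$. Then $$\sum_{\tau=1}^{t}|\mathfrak{B}_\tau|+\sum_{x\in V}\Bigl(\frac{f(x)}{2}+1\Bigr)\ \ge\ \frac{2^{d+1}-m}{d+1}\,|V|.$$ -/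

import Mathlib

/-- `K` is an `M`-complex, for a set `M` of natural numbers: all members of `K` have size in `M`,
and every subset of a member of `K` whose size lies in `M` is itself a member of `K`.
(The empty family is allowed.) -/
def IsMComplex {V : Type*} (M : Set ℕ) (K : Finset (Finset V)) : Prop :=
  (∀ F ∈ K, F.card ∈ M) ∧ ∀ F ∈ K, ∀ G : Finset V, G ⊆ F → G.card ∈ M → G ∈ K

/-- A mountain is an `M`-complex for `M = {2, 3, 4, …}`. -/
def IsMountain {V : Type*} (K : Finset (Finset V)) : Prop :=
  IsMComplex {n : ℕ | 2 ≤ n} K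

/-- The degree of the vertex `x` in the set system `K`: the number of members containing `x`. -/
def setDegree {V : Type*} [DecidableEq V] (K : Finset (Finset V)) (x : V) : ℕ :=
  (K.filter (fun F => x ∈ F)).card

/-! Give `x` the weight 1 + ∑ 1/|F| + f(x)/2, where F runs over the sets through `x` in all
mountains. Summed over `V`, these weights give the right side of the claim, so their average must be
at least T = (2^(d+1) - m)/(d+1). The weight of `x` is that of a lower family, `gluedLink`, in which
a set of size i weighs 1/(i+1): the empty set pays for the 1, and each of the f(x) isolated vertices
pays 1/2. The degree condition gives this family at least 2^d + 1 - m members.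

Among lower families of a given size, colexicographic initial segments are lightest
(`colexSum_card_le_familyWeight`), and more than d vertices cost an extra 1/2
(`colexSum_add_le_familyWeight`). Hence a vertex of weight below T has a link on exactly d vertices,
all coming from the first mountain K (`light_vertex_structure`). Its closed neighbourhood A is a
block: |A| = d + 1, A is not in K, and at most m - 1 of the sets of size at least two with x ∈ F ⊆ A
are missing from K.

Light vertices are compensated inside their blocks. If u sets through v ∈ A are missing, the degree
condition forces at least u - (m - 1) link members outside A, worth at least `gain`. The `share` of
v in A is its weight inside A plus this gain minus T. The shares in one block have nonnegative sum
(`sum_share_nonneg`), by an estimate for lower families on d + 1 points (`card_sub_le_sum_gain`).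
The shares of v over all its blocks sum to at most its weight minus T (`sum_share_le`), because two
blocks meeting in v have disjoint systems of sets through v and their respective light vertices.
Double counting finishes the proof. -/

open Finset

/-! ### Binary digit sums: sizes of finite sets listed in colexicographic order -/

/-- The number of ones in the binary expansion. -/
def bitSum : ℕ → ℕ
  | 0 => 0
  | n + 1 => (n + 1) % 2 + bitSum ((n + 1) / 2)
decreasing_by omega

theorem bitSum_zero : bitSum 0 = 0 := by rw [bitSum]

theorem bitSum_two_mul (n : ℕ) : bitSum (2 * n) = bitSum n := by
  cases n with
  | zero => simp
  | succ n =>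
    rw [show 2 * (n + 1) = (2 * n + 1) + 1 by ring, bitSum,
      show (2 * n + 1 + 1) % 2 = 0 by omega, show (2 * n + 1 + 1) / 2 = n + 1 by omega, zero_add]

theorem bitSum_two_mul_add_one (n : ℕ) : bitSum (2 * n + 1) = bitSum n + 1 := by
  rw [bitSum, show (2 * n + 1) % 2 = 1 by omega, show (2 * n + 1) / 2 = n by omega, add_comm]

theorem bitSum_pos {n : ℕ} (hn : 1 ≤ n) : 1 ≤ bitSum n := by
  induction n using Nat.strong_induction_on with
  | _ n ih =>
    obtain ⟨k, rfl | rfl⟩ : ∃ k, n = 2 * k ∨ n = 2 * k + 1 := ⟨n / 2, by omega⟩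
    · rw [bitSum_two_mul]; exact ih k (by omega) (by omega)
    · rw [bitSum_two_mul_add_one]; omega

theorem two_pow_bitSum_le (n : ℕ) : 2 ^ bitSum n ≤ n + 1 := by
  induction n using Nat.strong_induction_on with
  | _ n ih =>
    rcases Nat.eq_zero_or_pos n with rfl | hn
    · simp [bitSum_zero]
    obtain ⟨k, rfl | rfl⟩ : ∃ k, n = 2 * k ∨ n = 2 * k + 1 := ⟨n / 2, by omega⟩
    · rw [bitSum_two_mul]; have := ih k (by omega); omega
    · rw [bitSum_two_mul_add_one, pow_succ]; have := ih k (by omega); omega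

theorem bitSum_two_pow_add (k i : ℕ) (hi : i < 2 ^ k) : bitSum (2 ^ k + i) = bitSum i + 1 := by
  induction k generalizing i with
  | zero =>
    obtain rfl : i = 0 := by simpa using hi
    simpa using bitSum_two_mul_add_one 0
  | succ k ih =>
    rw [pow_succ] at hi ⊢
    obtain ⟨j, rfl | rfl⟩ : ∃ j, i = 2 * j ∨ i = 2 * j + 1 := ⟨i / 2, by omega⟩
    · rw [show 2 ^ k * 2 + 2 * j = 2 * (2 ^ k + j) by ring, bitSum_two_mul, bitSum_two_mul,
        ih j (by omega)]
    · rw [show 2 ^ k * 2 + (2 * j + 1) = 2 * (2 ^ k + j) + 1 by ring, bitSum_two_mul_add_one,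
        bitSum_two_mul_add_one, ih j (by omega)]

theorem bitSum_add_bitSum_compl (k i : ℕ) (hi : i < 2 ^ k) :
    bitSum i + bitSum (2 ^ k - 1 - i) = k := by
  induction k generalizing i with
  | zero =>
    obtain rfl : i = 0 := by simpa using hi
    simp [bitSum_zero]
  | succ k ih =>
    rw [pow_succ] at hi ⊢
    obtain ⟨j, rfl | rfl⟩ : ∃ j, i = 2 * j ∨ i = 2 * j + 1 := ⟨i / 2, by omega⟩
    · rw [show 2 ^ k * 2 - 1 - 2 * j = 2 * (2 ^ k - 1 - j) + 1 by omega, bitSum_two_mul,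
        bitSum_two_mul_add_one]
      have := ih j (by omega); omega
    · rw [show 2 ^ k * 2 - 1 - (2 * j + 1) = 2 * (2 ^ k - 1 - j) by omega, bitSum_two_mul,
        bitSum_two_mul_add_one]
      have := ih j (by omega); omega

/-! ### Weights of colexicographic initial segments -/

/-- The total weight of the first `n` finite sets in the colexicographic order,
where a set of size `i` has weight `g i`. -/
noncomputable def colexSum (g : ℕ → ℝ) (n : ℕ) : ℝ := ∑ i ∈ range n, g (bitSum i)

/-- The weight function induced on the link of a vertex. -/
def linkWeight (g : ℕ → ℝ) : ℕ → ℝ := fun i => g (i + 1)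

theorem linkWeight_antitone {g : ℕ → ℝ} (hg : Antitone g) : Antitone (linkWeight g) :=
  fun _ _ h => hg (Nat.succ_le_succ h)

theorem colexSum_zero (g : ℕ → ℝ) : colexSum g 0 = 0 := by simp [colexSum]

theorem colexSum_succ (g : ℕ → ℝ) (n : ℕ) :
    colexSum g (n + 1) = colexSum g n + g (bitSum n) := by
  simp [colexSum, sum_range_succ]

theorem colexSum_one (g : ℕ → ℝ) : colexSum g 1 = g 0 := by
  simp [colexSum, bitSum_zero]

/-- The sets coded by 2i and 2i + 1 differ only in the smallest point. This halving recursion drives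
the inductions below. -/
theorem colexSum_two_mul (g : ℕ → ℝ) (n : ℕ) :
    colexSum g (2 * n) = colexSum g n + colexSum (linkWeight g) n := by
  induction n with
  | zero => simp [colexSum_zero]
  | succ n ih =>
    rw [show 2 * (n + 1) = 2 * n + 1 + 1 by ring, colexSum_succ, colexSum_succ, ih,
      colexSum_succ, colexSum_succ, bitSum_two_mul, bitSum_two_mul_add_one]
    simp only [linkWeight]; ring

theorem colexSum_two_mul_add_one (g : ℕ → ℝ) (n : ℕ) :
    colexSum g (2 * n + 1) = colexSum g (n + 1) + colexSum (linkWeight g) n := by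
  rw [colexSum_succ, colexSum_two_mul, colexSum_succ, bitSum_two_mul]; ring

theorem colexSum_two_pow_add (g : ℕ → ℝ) (k r : ℕ) (hr : r ≤ 2 ^ k) :
    colexSum g (2 ^ k + r) = colexSum g (2 ^ k) + colexSum (linkWeight g) r := by
  induction r with
  | zero => simp [colexSum_zero]
  | succ r ih =>
    rw [← add_assoc, colexSum_succ, ih (by omega), colexSum_succ, bitSum_two_pow_add k r (by omega)]
    simp only [linkWeight]; ring

theorem colexSum_mono {g : ℕ → ℝ} (hg : ∀ i, 0 ≤ g i) : Monotone (colexSum g) := by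
  refine monotone_nat_of_le_succ fun n => ?_
  rw [colexSum_succ]
  linarith [hg (bitSum n)]

/-- Complementation in a d-set reverses the colexicographic order, so the last `k` subsets are the
complements of the first `k`. -/
theorem colexSum_two_pow_sub (g : ℕ → ℝ) (d k : ℕ) (hk : k ≤ 2 ^ d) :
    colexSum g (2 ^ d) = colexSum g (2 ^ d - k) + ∑ j ∈ range k, g (d - bitSum j) := by
  induction k with
  | zero => simp
  | succ k ih =>
    rw [ih (by omega), sum_range_succ, show 2 ^ d - k = (2 ^ d - (k + 1)) + 1 by omega,
      colexSum_succ]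
    have := bitSum_add_bitSum_compl d k (by omega)
    rw [show bitSum (2 ^ d - (k + 1)) = d - bitSum k by
      rw [show 2 ^ d - (k + 1) = 2 ^ d - 1 - k by omega]; omega]
    ring

/-- Numerical core of the weighted Kruskal–Katona argument: `a` and `b` play the sizes of the
deletion and the link of a vertex. Induction by halving both numbers. -/
theorem colexSum_add_le_of_le {g : ℕ → ℝ} (hg : Antitone g) {a b : ℕ} (hab : b ≤ a) :
    colexSum g (a + b) ≤ colexSum g a + colexSum (linkWeight g) b := by
  induction a using Nat.strong_induction_on generalizing b g with
  | _ a ih =>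
    rcases Nat.eq_zero_or_pos b with rfl | hb
    · simp [colexSum_zero]
    rcases hab.eq_or_lt with rfl | hlt
    · rw [← two_mul, colexSum_two_mul]
    obtain ⟨p, hp⟩ : ∃ p, a = 2 * p ∨ a = 2 * p + 1 := ⟨a / 2, by omega⟩
    obtain ⟨q, hq⟩ : ∃ q, b = 2 * q ∨ b = 2 * q + 1 := ⟨b / 2, by omega⟩
    have hg' := linkWeight_antitone hg
    rcases hp with rfl | rfl <;> rcases hq with rfl | rfl
    · have h₁ := ih p (by omega) hg (b := q) (by omega)
      have h₂ := ih p (by omega) hg' (b := q) (by omega)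
      rw [show 2 * p + 2 * q = 2 * (p + q) by ring]
      simp only [colexSum_two_mul] at *
      linarith
    · have h₁ := ih p (by omega) hg (b := q + 1) (by omega)
      have h₂ := ih p (by omega) hg' (b := q) (by omega)
      rw [show 2 * p + (2 * q + 1) = 2 * (p + q) + 1 by ring]
      simp only [colexSum_two_mul, colexSum_two_mul_add_one, ← add_assoc] at *
      linarith
    · have h₁ := ih (p + 1) (by omega) hg (b := q) (by omega)
      have h₂ := ih p (by omega) hg' (b := q) (by omega)
      rw [show 2 * p + 1 + 2 * q = 2 * (p + q) + 1 by ring]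
      rw [show p + 1 + q = p + q + 1 by ring] at h₁
      simp only [colexSum_two_mul, colexSum_two_mul_add_one, ← add_assoc] at *
      linarith
    · have h₁ := ih (p + 1) (by omega) hg (b := q) (by omega)
      have h₂ := ih p (by omega) hg' (b := q + 1) (by omega)
      -- Only when both numbers are odd do the halves fail to match exactly; monotonicity of `g`
      -- absorbs the discrepancy.
      have h₃ := hg' (Nat.le_succ (bitSum q))
      rw [show 2 * p + 1 + (2 * q + 1) = 2 * (p + q + 1) by ring]
      rw [show p + 1 + q = p + q + 1 by ring] at h₁
      rw [colexSum_succ (linkWeight (linkWeight g))] at h₂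
      rw [colexSum_two_mul, colexSum_two_mul_add_one, colexSum_two_mul_add_one,
        colexSum_succ (linkWeight g) q]
      simp only [linkWeight, ← add_assoc, Nat.succ_eq_add_one] at *
      linarith

/-- Gluing two segments along the empty set is no lighter than a single segment of the same total
size. Halving again, with subadditivity for the link weight supplied by the induction hypothesis. -/
theorem colexSum_glue_le {g : ℕ → ℝ} (hg : Antitone g) (a b : ℕ) :
    colexSum g (a + b + 1) + g 0 ≤ colexSum g (a + 1) + colexSum g (b + 1) := by
  induction hn : a + b using Nat.strong_induction_on generalizing a b g with
  | _ n ih =>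
    subst hn
    rcases Nat.eq_zero_or_pos a with rfl | ha
    · simp [colexSum_one, add_comm]
    rcases Nat.eq_zero_or_pos b with rfl | hb
    · simp [colexSum_one]
    have hg' := linkWeight_antitone hg
    obtain ⟨p, hp⟩ : ∃ p, a = 2 * p ∨ a = 2 * p + 1 := ⟨a / 2, by omega⟩
    obtain ⟨q, hq⟩ : ∃ q, b = 2 * q ∨ b = 2 * q + 1 := ⟨b / 2, by omega⟩
    -- subadditivity of `colexSum (linkWeight g)` at smaller arguments
    have hsub : ∀ p q : ℕ, p + q < a + b + 2 →
        colexSum (linkWeight g) (p + q) ≤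
          colexSum (linkWeight g) p + colexSum (linkWeight g) q := by
      intro p q hpq
      rcases p with _ | p
      · simp [colexSum_zero]
      rcases q with _ | q
      · simp [colexSum_zero]
      have h := ih (p + q) (by omega) hg' p q rfl
      rw [show p + 1 + (q + 1) = p + q + 1 + 1 by ring, colexSum_succ]
      have := hg' (Nat.zero_le (bitSum (p + q + 1)))
      linarith
    rcases hp with rfl | rfl <;> rcases hq with rfl | rfl
    · have h₁ := ih (p + q) (by omega) hg p q rfl
      have h₂ := hsub p q (by omega)
      rw [show 2 * p + 2 * q + 1 = 2 * (p + q) + 1 by ring]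
      simp only [colexSum_two_mul_add_one]
      linarith
    · have h₁ := ih (p + q) (by omega) hg p q rfl
      have h₂ := hsub p (q + 1) (by omega)
      rw [show 2 * p + (2 * q + 1) + 1 = 2 * (p + q + 1) by ring,
        show 2 * q + 1 + 1 = 2 * (q + 1) by ring]
      simp only [colexSum_two_mul_add_one, colexSum_two_mul, ← add_assoc] at *
      linarith
    · have h₁ := ih (p + q) (by omega) hg p q rfl
      have h₂ := hsub (p + 1) q (by omega)
      rw [show 2 * p + 1 + 2 * q + 1 = 2 * (p + q + 1) by ring,
        show 2 * p + 1 + 1 = 2 * (p + 1) by ring]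
      rw [show p + 1 + q = p + q + 1 by ring] at h₂
      simp only [colexSum_two_mul_add_one, colexSum_two_mul] at *
      linarith
    · have h₁ := ih (p + q) (by omega) hg p q rfl
      have h₂ := ih (p + q) (by omega) hg' p q rfl
      rw [show 2 * p + 1 + (2 * q + 1) + 1 = 2 * (p + q + 1) + 1 by ring,
        show 2 * p + 1 + 1 = 2 * (p + 1) by ring, show 2 * q + 1 + 1 = 2 * (q + 1) by ring]
      simp only [colexSum_two_mul_add_one, colexSum_two_mul]
      rw [colexSum_succ g (p + q + 1)]
      have := hg (bitSum_pos (n := p + q + 1) (by omega))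
      simp only [linkWeight, zero_add] at *
      linarith

theorem colexSum_add_le {g : ℕ → ℝ} (hg : Antitone g) (a b : ℕ) :
    colexSum g (a + b) ≤ colexSum g a + colexSum g b := by
  rcases a with _ | a
  · simp [colexSum_zero]
  rcases b with _ | b
  · simp [colexSum_zero]
  rw [show a + 1 + (b + 1) = a + b + 1 + 1 by ring, colexSum_succ]
  linarith [colexSum_glue_le hg a b, hg (Nat.zero_le (bitSum (a + b + 1)))]

/-! ### Minimum weight of lower families -/

section LowerFamilies

variable {α : Type*} [DecidableEq α]

/-- The weight of a set system, where a set of size `i` has weight `g i`. -/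
noncomputable def familyWeight (g : ℕ → ℝ) (L : Finset (Finset α)) : ℝ := ∑ G ∈ L, g G.card

theorem familyWeight_split (g : ℕ → ℝ) (L : Finset (Finset α)) (z : α) :
    familyWeight g L = familyWeight g (L.nonMemberSubfamily z) +
      familyWeight (linkWeight g) (L.memberSubfamily z) := by
  unfold familyWeight
  rw [← sum_filter_add_sum_filter_not L (fun G => z ∈ G), add_comm]
  congr 1
  rw [← image_insert_memberSubfamily, sum_image]
  · refine sum_congr rfl fun G hG => ?_
    rw [card_insert_of_notMem (mem_memberSubfamily.1 hG).2, linkWeight]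
  · intro G hG H hH h
    rw [← erase_insert (mem_memberSubfamily.1 hG).2, h, erase_insert (mem_memberSubfamily.1 hH).2]

theorem memberSubfamily_card_pos {L : Finset (Finset α)} (hL : IsLowerSet (L : Set (Finset α)))
    {z : α} (hz : z ∈ L.biUnion id) : 1 ≤ #(L.memberSubfamily z) := by
  obtain ⟨G, hG, hzG⟩ := mem_biUnion.1 hz
  refine card_pos.2 ⟨∅, mem_memberSubfamily.2 ⟨?_, by simp⟩⟩
  exact hL (show insert z ∅ ≤ G by simpa using hzG) hG

theorem memberSubfamily_card_le {L : Finset (Finset α)} (hL : IsLowerSet (L : Set (Finset α)))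
    (z : α) : #(L.memberSubfamily z) ≤ #(L.nonMemberSubfamily z) :=
  card_le_card hL.memberSubfamily_subset_nonMemberSubfamily

/-- Among all lower sets of a given size, initial segments of the colexicographic order
have the least weight. -/
theorem colexSum_card_le_familyWeight {g : ℕ → ℝ} (hg : Antitone g) {L : Finset (Finset α)}
    (hL : IsLowerSet (L : Set (Finset α))) : colexSum g #L ≤ familyWeight g L := by
  induction hn : #L using Nat.strong_induction_on generalizing L g with
  | _ n ih =>
    subst hn
    rcases (L.biUnion id).eq_empty_or_nonempty with h | ⟨z, hz⟩
    · have hsub : L ⊆ {∅} := by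
        intro G hG
        rw [mem_singleton, eq_empty_iff_forall_notMem]
        intro z hz
        exact notMem_empty z (h ▸ mem_biUnion.2 ⟨G, hG, hz⟩)
      rcases subset_singleton_iff.1 hsub with rfl | rfl
      · simp [colexSum_zero, familyWeight]
      · simp [colexSum_one, familyWeight]
    · have h₁ := memberSubfamily_card_pos hL hz
      have h₂ := memberSubfamily_card_le hL z
      have h₃ := card_memberSubfamily_add_card_nonMemberSubfamily z L
      have h₄ := ih _ (by omega) hg (hL.nonMemberSubfamily (a := z)) rfl
      have h₅ := ih _ (by omega) (linkWeight_antitone hg) (hL.memberSubfamily (a := z)) rfl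
      have h₆ := colexSum_add_le_of_le hg h₂
      rw [familyWeight_split g L z, ← h₃, add_comm #(L.memberSubfamily z)]
      linarith

/-- If link and deletion agreed at every vertex, vertices could be added freely to the empty set,
and `L` would be a full power set. -/
theorem exists_memberSubfamily_card_lt {L : Finset (Finset α)}
    (hL : IsLowerSet (L : Set (Finset α))) (hne : L.Nonempty)
    (hcard : #L < 2 ^ #(L.biUnion id)) :
    ∃ z ∈ L.biUnion id, #(L.memberSubfamily z) < #(L.nonMemberSubfamily z) := by
  by_contra! h
  have key : ∀ S : Finset α, S ⊆ L.biUnion id → S ∈ L := by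
    intro S
    induction S using Finset.induction_on with
    | empty =>
      obtain ⟨G, hG⟩ := hne
      exact fun _ => hL (show ∅ ≤ G by simp) hG
    | insert z S hzS ih =>
      intro hS
      rw [insert_subset_iff] at hS
      have heq := eq_of_subset_of_card_le
        (hL.memberSubfamily_subset_nonMemberSubfamily (a := z)) (h z hS.1)
      have : S ∈ L.nonMemberSubfamily z := mem_nonMemberSubfamily.2 ⟨ih hS.2, hzS⟩
      rw [← heq] at this
      exact (mem_memberSubfamily.1 this).1
  have : (L.biUnion id).powerset ⊆ L := fun S hS => key S (mem_powerset.1 hS)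
  have := card_le_card this
  rw [card_powerset] at this
  omega

/-- A lower set of size at most `2 ^ d + 1` with more than `d` vertices weighs at least as much as
an initial segment of the colexicographic order together with one additional vertex. -/
theorem colexSum_add_le_familyWeight {d : ℕ} {g : ℕ → ℝ} (hg : Antitone g)
    {L : Finset (Finset α)} (hL : IsLowerSet (L : Set (Finset α)))
    (hcard : #L ≤ 2 ^ d + 1) (hv : d + 1 ≤ #(L.biUnion id)) :
    colexSum g (#L - 1) + g 1 ≤ familyWeight g L := by
  induction d generalizing L with
  | zero =>
    obtain ⟨z, hz⟩ := card_pos.1 (by omega : 0 < #(L.biUnion id))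
    have h₁ := memberSubfamily_card_pos hL hz
    have h₂ := memberSubfamily_card_le hL z
    have h₃ := card_memberSubfamily_add_card_nonMemberSubfamily z L
    have h₄ := colexSum_card_le_familyWeight hg (hL.nonMemberSubfamily (a := z))
    have h₅ := colexSum_card_le_familyWeight (linkWeight_antitone hg) (hL.memberSubfamily (a := z))
    rw [pow_zero] at hcard
    rw [show #(L.nonMemberSubfamily z) = 1 by omega, colexSum_one] at h₄
    rw [show #(L.memberSubfamily z) = 1 by omega, colexSum_one] at h₅
    rw [show #L - 1 = 1 by omega, colexSum_one, familyWeight_split g L z]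
    simp only [linkWeight, zero_add] at *
    linarith
  | succ d ih =>
    have hne : L.Nonempty := by
      rw [nonempty_iff_ne_empty]
      rintro rfl
      simp at hv
    have hpow : 2 ^ (d + 1) + 1 < 2 ^ #(L.biUnion id) := by
      have : 2 ^ (d + 2) ≤ 2 ^ #(L.biUnion id) := Nat.pow_le_pow_right (by norm_num) hv
      have := Nat.one_le_two_pow (n := d)
      rw [pow_succ] at *
      omega
    obtain ⟨z, hz, hlt⟩ := exists_memberSubfamily_card_lt hL hne (by omega)
    have h₁ := memberSubfamily_card_pos hL hz
    have h₃ := card_memberSubfamily_add_card_nonMemberSubfamily z L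
    have h₅ := colexSum_card_le_familyWeight (linkWeight_antitone hg) (hL.memberSubfamily (a := z))
    rw [familyWeight_split g L z]
    -- A small deletion still has all vertices but `z`, so induction applies to it; strictness in
    -- the choice of `z` leaves room for the -1.
    rcases le_or_gt #(L.nonMemberSubfamily z) (2 ^ d) with ha | ha
    · have hsub : (L.biUnion id).erase z ⊆ (L.nonMemberSubfamily z).biUnion id := by
        intro y hy
        obtain ⟨hyz, hy⟩ := mem_erase.1 hy
        obtain ⟨G, hG, hyG⟩ := mem_biUnion.1 hy
        refine mem_biUnion.2 ⟨{y}, mem_nonMemberSubfamily.2 ⟨?_, ?_⟩, by simp⟩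
        · exact hL (show {y} ≤ G by simpa using hyG) hG
        · simpa using hyz.symm
      have h₆ := card_le_card hsub
      rw [card_erase_of_mem hz] at h₆
      have h₄ := ih (hL.nonMemberSubfamily (a := z)) (by omega) (by omega)
      have h₇ := colexSum_add_le_of_le hg
        (show #(L.memberSubfamily z) ≤ #(L.nonMemberSubfamily z) - 1 by omega)
      rw [show #(L.nonMemberSubfamily z) - 1 + #(L.memberSubfamily z) = #L - 1 by omega] at h₇
      linarith
    -- A large deletion is compared with a full d-cube plus an excess under link weight; gluing this
    -- excess to the link of `z` frees one extra `g 1`.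
    · have h₄ := colexSum_card_le_familyWeight hg (hL.nonMemberSubfamily (a := z))
      obtain ⟨a, ha'⟩ : ∃ a, #(L.nonMemberSubfamily z) = 2 ^ d + (a + 1) :=
        ⟨#(L.nonMemberSubfamily z) - 2 ^ d - 1, by omega⟩
      obtain ⟨b, hb⟩ : ∃ b, #(L.memberSubfamily z) = b + 1 := ⟨_, (Nat.sub_add_cancel h₁).symm⟩
      rw [pow_succ] at hcard
      rw [ha', colexSum_two_pow_add _ _ _ (by omega)] at h₄
      rw [hb] at h₅
      have h₆ := colexSum_glue_le (linkWeight_antitone hg) a b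
      rw [show #L - 1 = 2 ^ d + (a + b + 1) by omega, colexSum_two_pow_add _ _ _ (by omega)]
      simp only [linkWeight, zero_add] at *
      linarith

/-- The members of a lower set that are not contained in `D` weigh at least as much as an initial
segment of the colexicographic order of the same size with one common vertex attached. -/
theorem familyWeight_inter_powerset_add_le {g : ℕ → ℝ} (hg : Antitone g)
    {L : Finset (Finset α)} (hL : IsLowerSet (L : Set (Finset α))) (D : Finset α) :
    familyWeight g (L.filter (· ⊆ D)) +
      colexSum (linkWeight g) (#L - #(L.filter (· ⊆ D))) ≤ familyWeight g L := by
  induction hn : #L using Nat.strong_induction_on generalizing L with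
  | _ n ih =>
    subst hn
    by_cases h : ∀ G ∈ L, G ⊆ D
    · rw [filter_true_of_mem h]
      simp [colexSum_zero]
    push Not at h
    obtain ⟨G, hG, hGD⟩ := h
    obtain ⟨z, hzG, hzD⟩ := not_subset.1 hGD
    have h₁ := memberSubfamily_card_pos hL (mem_biUnion.2 ⟨G, hG, hzG⟩)
    have h₃ := card_memberSubfamily_add_card_nonMemberSubfamily z L
    have h₅ := colexSum_card_le_familyWeight (linkWeight_antitone hg) (hL.memberSubfamily (a := z))
    have h₄ := ih _ (by omega) (hL.nonMemberSubfamily (a := z)) rfl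
    have h₆ : (L.nonMemberSubfamily z).filter (· ⊆ D) = L.filter (· ⊆ D) := by
      ext H
      simp only [mem_filter, mem_nonMemberSubfamily]
      exact ⟨fun h => ⟨h.1.1, h.2⟩, fun h => ⟨⟨h.1, fun hz => hzD (h.2 hz)⟩, h.2⟩⟩
    have h₇ := card_filter_le (L.nonMemberSubfamily z) (· ⊆ D)
    rw [h₆] at h₄ h₇
    -- Deleting `z` keeps everything inside `D`; subadditivity merges the bound for the link of `z`
    -- with the one for the remaining outside sets.
    have h₈ := colexSum_add_le (linkWeight_antitone hg)
      (#(L.nonMemberSubfamily z) - #(L.filter (· ⊆ D))) #(L.memberSubfamily z)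
    rw [show #(L.nonMemberSubfamily z) - #(L.filter (· ⊆ D)) + #(L.memberSubfamily z)
      = #L - #(L.filter (· ⊆ D)) by omega] at h₈
    rw [familyWeight_split g L z]
    linarith

theorem sum_powerset_eq_colexSum (g : ℕ → ℝ) (P : Finset α) :
    ∑ G ∈ P.powerset, g #G = colexSum g (2 ^ #P) := by
  induction P using Finset.induction_on generalizing g with
  | empty => simp [colexSum_one]
  | insert z P hz ih =>
    rw [sum_powerset_insert hz, card_insert_of_notMem hz, pow_succ, mul_comm, colexSum_two_mul,
      ih, ← ih (linkWeight g)]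
    congr 1
    refine sum_congr rfl fun G hG => ?_
    rw [card_insert_of_notMem fun h => hz (mem_powerset.1 hG h), linkWeight]

end LowerFamilies

/-! ### The weight 1/(i+1) and the function `gain` -/

/-- The weight `1 / (i + 1)` of a set of size `i` in the link of a vertex. -/
noncomputable def recWeight : ℕ → ℝ := fun i => 1 / ((i : ℝ) + 1)

theorem recWeight_antitone : Antitone recWeight := by
  intro i j h
  unfold recWeight
  have : (i : ℝ) ≤ j := by exact_mod_cast h
  gcongr

theorem recWeight_nonneg (i : ℕ) : 0 ≤ recWeight i := by unfold recWeight; positivity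

theorem colexSum_recWeight_two_pow (d : ℕ) :
    colexSum recWeight (2 ^ d) = (2 ^ (d + 1) - 1) / ((d : ℝ) + 1) := by
  have h := sum_powerset_eq_colexSum recWeight (range d)
  rw [card_range] at h
  rw [← h, sum_powerset_apply_card recWeight, card_range, eq_div_iff (by positivity), sum_mul]
  have h₂ : ∀ i ∈ range (d + 1), (d.choose i • recWeight i) * ((d : ℝ) + 1)
      = ((d + 1).choose (i + 1) : ℝ) := by
    intro i _
    have := Nat.add_one_mul_choose_eq d i
    have : ((d : ℝ) + 1) * d.choose i = (d + 1).choose (i + 1) * ((i : ℝ) + 1) := by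
      exact_mod_cast this
    rw [recWeight, nsmul_eq_mul]
    field_simp
    linarith
  rw [sum_congr rfl h₂]
  have h₃ := Nat.sum_range_choose (d + 1)
  rw [sum_range_succ'] at h₃
  have h₄ : (∑ i ∈ range (d + 1), ((d + 1).choose (i + 1) : ℝ)) + 1 = 2 ^ (d + 1) := by
    exact_mod_cast h₃
  linarith

theorem three_mul_bitSum_le {d j : ℕ} (hd : 5 ≤ d) (hj : j < d) : 3 * bitSum j ≤ d + 1 := by
  have h := two_pow_bitSum_le j
  generalize bitSum j = s at *
  rcases lt_or_ge s 3 with hs | hs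
  · omega
  · have : 3 * s ≤ 2 ^ s + 1 := by
      induction s, hs using Nat.le_induction with
      | base => norm_num
      | succ s hs ih =>
        rw [pow_succ] at *
        have := ih (by omega)
        omega
    omega

/-- The 1/2 is the weight of one additional vertex, so a link with too many vertices is not light.
The full cube exceeds the target by (m-1)/(d+1), and the `m` removed sets have size at least d -
`bitSum j`. -/
theorem colexSum_recWeight_slack {d m : ℕ} (hd : 4 ≤ d) (hmd : m ≤ d) (hm : 3 ≤ m) :
    (2 ^ (d + 1) - (m : ℝ)) / ((d : ℝ) + 1) ≤ colexSum recWeight (2 ^ d - m) + 1 / 2 := by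
  have hpow : d < 2 ^ d := Nat.lt_two_pow_self
  have h := colexSum_two_pow_sub recWeight d m (by omega)
  rw [colexSum_recWeight_two_pow] at h
  have hsum : ∑ j ∈ range m, recWeight (d - bitSum j) ≤ 1 / 2 + ((m : ℝ) - 1) / (d + 1) := by
    -- The bound 3 · `bitSum j` ≤ d + 1 fails for d = 4, j = 3, so that case is computed.
    rcases hd.eq_or_lt with rfl | hd
    · have e1 : bitSum 1 = 1 := bitSum_two_mul_add_one 0 |>.trans (by rw [bitSum_zero])
      have e2 : bitSum 2 = 1 := (bitSum_two_mul 1).trans e1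
      have e3 : bitSum 3 = 2 := (bitSum_two_mul_add_one 1).trans (by rw [e1])
      interval_cases m <;> norm_num [sum_range_succ, bitSum_zero, e1, e2, e3, recWeight]
    · obtain ⟨k, rfl⟩ : ∃ k, m = k + 1 := ⟨m - 1, by omega⟩
      have hterm : ∀ j ∈ range k, recWeight (d - bitSum (j + 1)) ≤ 3 / (2 * ((d : ℝ) + 1)) := by
        intro j hj
        have h3 := three_mul_bitSum_le (j := j + 1) hd (by have := mem_range.1 hj; omega)
        have h4 : (3 * bitSum (j + 1) : ℝ) ≤ d + 1 := by exact_mod_cast h3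
        rw [recWeight, Nat.cast_sub (by omega), div_le_div_iff₀ (by linarith) (by positivity)]
        linarith
      rw [sum_range_succ', bitSum_zero, Nat.sub_zero]
      have h5 := sum_le_card_nsmul _ _ _ hterm
      rw [card_range, nsmul_eq_mul] at h5
      have h6 : (k : ℝ) * (3 / (2 * ((d : ℝ) + 1))) + recWeight d
          ≤ 1 / 2 + ((k + 1 : ℕ) - 1 : ℝ) / (d + 1) := by
        rw [recWeight]
        push_cast
        have : (k : ℝ) + 1 ≤ d := by exact_mod_cast hmd
        rw [← sub_nonneg]
        have : 1 / 2 + ((k : ℝ) + 1 - 1) / (d + 1) - (k * (3 / (2 * ((d : ℝ) + 1))) + 1 / (d + 1))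
            = (d - k - 1) / (2 * ((d : ℝ) + 1)) := by
          field_simp; ring
        rw [this]
        apply div_nonneg <;> [linarith; positivity]
      linarith
  have : (2 ^ (d + 1) - (m : ℝ)) / ((d : ℝ) + 1)
      = (2 ^ (d + 1) - 1) / ((d : ℝ) + 1) - ((m : ℝ) - 1) / (d + 1) := by ring
  rw [this, h]
  linarith

/-- A lower bound for the weight of `k` additional sets at a vertex. -/
noncomputable def gain (k : ℕ) : ℝ :=
  if k = 0 then 0 else min 2 (max (((k : ℝ) + 1) / 4) ((k : ℝ) / 3))

theorem gain_zero : gain 0 = 0 := by simp [gain]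

theorem gain_of_pos {k : ℕ} (hk : 1 ≤ k) :
    gain k = min 2 (max (((k : ℝ) + 1) / 4) ((k : ℝ) / 3)) := by
  rw [gain, if_neg (by omega)]

theorem gain_nonneg (k : ℕ) : 0 ≤ gain k := by
  unfold gain
  split_ifs
  · exact le_rfl
  · positivity

theorem gain_mono : Monotone gain := by
  intro i j h
  rcases Nat.eq_zero_or_pos i with rfl | hi
  · rw [gain_zero]; exact gain_nonneg j
  · rw [gain_of_pos hi, gain_of_pos (by omega)]
    have : (i : ℝ) ≤ j := by exact_mod_cast h
    gcongr

theorem gain_le_two (k : ℕ) : gain k ≤ 2 := by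
  unfold gain
  split_ifs
  · norm_num
  · exact min_le_left _ _

theorem div_three_le_gain {k : ℕ} (hk : k ≤ 6) : (k : ℝ) / 3 ≤ gain k := by
  rcases Nat.eq_zero_or_pos k with rfl | hk'
  · simp [gain_zero]
  rw [gain_of_pos hk']
  refine le_min ?_ (le_max_right _ _)
  have : (k : ℝ) ≤ 6 := by exact_mod_cast hk
  linarith

theorem gain_eq_two {k : ℕ} (hk : 6 ≤ k) : gain k = 2 := by
  refine le_antisymm (gain_le_two k) ?_
  calc (2 : ℝ) = ((6 : ℕ) : ℝ) / 3 := by norm_num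
    _ ≤ gain 6 := div_three_le_gain le_rfl
    _ ≤ gain k := gain_mono hk

theorem gain_one : gain 1 = 1 / 2 := by rw [gain_of_pos le_rfl]; norm_num

theorem gain_two : gain 2 = 3 / 4 := by rw [gain_of_pos (by norm_num)]; norm_num

theorem gain_three : gain 3 = 1 := by rw [gain_of_pos (by norm_num)]; norm_num

theorem gain_four : gain 4 = 4 / 3 := by rw [gain_of_pos (by norm_num)]; norm_num

theorem gain_five : gain 5 = 5 / 3 := by rw [gain_of_pos (by norm_num)]; norm_num

/-- The exact sums for k = 1, …, 6 are 1/2, 5/6, 7/6, 17/12, 7/4, 2; monotonicity covers larger `k`.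
-/
theorem gain_le_colexSum (k : ℕ) : gain k ≤ colexSum (linkWeight recWeight) k := by
  have hmono : Monotone (colexSum (linkWeight recWeight)) :=
    colexSum_mono fun i => recWeight_nonneg _
  have e1 : bitSum 1 = 1 := bitSum_two_mul_add_one 0 |>.trans (by rw [bitSum_zero])
  have e2 : bitSum 2 = 1 := (bitSum_two_mul 1).trans e1
  have e3 : bitSum 3 = 2 := (bitSum_two_mul_add_one 1).trans (by rw [e1])
  have e4 : bitSum 4 = 1 := (bitSum_two_mul 2).trans e2
  have e5 : bitSum 5 = 2 := (bitSum_two_mul_add_one 2).trans (by rw [e2])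
  rcases le_or_gt 6 k with hk | hk
  · rw [gain_eq_two hk]
    refine le_trans ?_ (hmono hk)
    norm_num [colexSum, sum_range_succ, bitSum_zero, e1, e2, e3, e4, e5, linkWeight, recWeight]
  · interval_cases k <;>
    norm_num [colexSum, sum_range_succ, bitSum_zero, e1, e2, e3, e4, linkWeight, recWeight,
      gain_zero, gain_one, gain_two, gain_three, gain_four, gain_five]

/-! ### Gains pay for the missing sets of a block -/

section Gain

variable {α : Type*} [DecidableEq α]

theorem memberSubfamily_card_le_two_pow {L : Finset (Finset α)}
    (hL : IsLowerSet (L : Set (Finset α))) (x v : α) (N : Finset α)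
    (hN : ∀ u, u ≠ x → u ≠ v → {v, u} ∈ L → u ∈ N) :
    #(L.memberSubfamily v) ≤ 2 * 2 ^ #N := by
  have hsub : L.memberSubfamily v ⊆ (insert x N).powerset := by
    intro G hG
    obtain ⟨hG, hv⟩ := mem_memberSubfamily.1 hG
    rw [mem_powerset]
    intro u hu
    by_cases hux : u = x
    · simp [hux]
    · refine mem_insert_of_mem (hN u hux (fun h => hv (h ▸ hu)) (hL ?_ hG))
      simp only [insert_subset_iff, singleton_subset_iff]
      exact ⟨mem_insert_self _ _, mem_insert_of_mem hu⟩
  calc #(L.memberSubfamily v) ≤ 2 ^ #(insert x N) := by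
        rw [← card_powerset]; exact card_le_card hsub
    _ ≤ 2 ^ (#N + 1) := Nat.pow_le_pow_right (by norm_num) (card_insert_le _ _)
    _ = 2 * 2 ^ #N := by ring

/-- The pairs of a set system that avoid `x`. -/
def pairsAvoiding (L : Finset (Finset α)) (x : α) : Finset (Finset α) :=
  L.filter fun P => x ∉ P ∧ #P = 2

/-- The deletion of `x` contains the empty set, all singletons other than {x}, and the pairs
avoiding `x`. -/
theorem card_vertices_add_card_pairs_le {L : Finset (Finset α)}
    (hL : IsLowerSet (L : Set (Finset α))) {x : α} (hx : x ∈ L.biUnion id) :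
    #(L.biUnion id) + #(pairsAvoiding L x) ≤ #(L.nonMemberSubfamily x) := by
  set M := L.biUnion id
  have hatom : ∀ v ∈ M, {v} ∈ L := fun v hv => by
    obtain ⟨G, hG, hvG⟩ := mem_biUnion.1 hv
    exact hL (show {v} ≤ G by simpa using hvG) hG
  have hempty : ∅ ∈ L := hL (show ∅ ≤ {x} by simp) (hatom x hx)
  set S : Finset (Finset α) := (M.erase x).image fun v => {v}
  have hS : #S = #M - 1 := by
    rw [card_image_of_injective _ singleton_injective, card_erase_of_mem hx]
  have hsub : insert ∅ (S ∪ pairsAvoiding L x) ⊆ L.nonMemberSubfamily x := by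
    intro G hG
    rw [mem_nonMemberSubfamily]
    rcases mem_insert.1 hG with rfl | hG
    · exact ⟨hempty, by simp⟩
    rcases mem_union.1 hG with hG | hG
    · obtain ⟨v, hv, rfl⟩ := mem_image.1 hG
      obtain ⟨hvx, hv⟩ := mem_erase.1 hv
      exact ⟨hatom v hv, by simpa using hvx.symm⟩
    · obtain ⟨h₁, h₂, -⟩ := mem_filter.1 hG
      exact ⟨h₁, h₂⟩
  have hdisj : Disjoint S (pairsAvoiding L x) := by
    rw [disjoint_left]
    intro G hG hG'
    obtain ⟨v, -, rfl⟩ := mem_image.1 hG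
    have := (mem_filter.1 hG').2.2
    simp at this
  have hnot : ∅ ∉ S ∪ pairsAvoiding L x := by
    intro h
    rcases mem_union.1 h with h | h
    · obtain ⟨v, -, hv⟩ := mem_image.1 h
      exact singleton_ne_empty v hv
    · have := (mem_filter.1 h).2.2
      simp at this
  have := card_le_card hsub
  rw [card_insert_of_notMem hnot, card_union_of_disjoint hdisj, hS] at this
  have : 0 < #M := card_pos.2 ⟨x, hx⟩
  omega

/-- The neighbours of `v` in the graph formed by the pairs avoiding `x`. -/
def pairNeighbours (L : Finset (Finset α)) (x v : α) : Finset α :=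
  ((L.biUnion id).erase x).filter fun u => u ≠ v ∧ {v, u} ∈ L

theorem sum_card_pairNeighbours_le (L : Finset (Finset α)) (x : α) (S : Finset α) (hx : x ∉ S) :
    ∑ v ∈ S, #(pairNeighbours L x v) ≤ 2 * #(pairsAvoiding L x) := by
  calc ∑ v ∈ S, #(pairNeighbours L x v)
      ≤ ∑ v ∈ S, #((pairsAvoiding L x).filter fun P => v ∈ P) := by
        refine sum_le_sum fun v hv => ?_
        refine card_le_card_of_injOn (fun u => {v, u}) ?_ ?_
        · intro u hu
          obtain ⟨hu₁, huv, hvu⟩ := mem_filter.1 hu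
          have hux := (mem_erase.1 hu₁).1
          have hxv : x ≠ v := fun h => hx (h ▸ hv)
          refine mem_filter.2 ⟨mem_filter.2 ⟨hvu, ?_, card_pair huv.symm⟩, mem_insert_self _ _⟩
          simp [hxv, hux.symm]
        · intro u hu w hw h
          have huv := (mem_filter.1 hu).2.1
          have : u ∈ ({v, w} : Finset α) := by
            rw [← show ({v, u} : Finset α) = {v, w} from h]; simp
          simpa [huv] using this
    _ = ∑ P ∈ pairsAvoiding L x, #(S.filter fun v => v ∈ P) := by
        simp only [card_filter]
        rw [sum_comm]
    _ ≤ ∑ P ∈ pairsAvoiding L x, 2 := by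
        refine sum_le_sum fun P hP => ?_
        rw [← (mem_filter.1 hP).2.2]
        exact card_le_card fun v hv => (mem_filter.1 hv).2
    _ = 2 * #(pairsAvoiding L x) := by simp [mul_comm]

/-- Let e be the left side. Since the deletion of `x` is small, `L` misses at least two points of
`A`, and each of these earns the full gain of e. Vertices of `L` with few neighbours lie in few sets
and contribute the rest. -/
theorem card_sub_le_sum_gain {d m : ℕ} (hd : 4 ≤ d) (hmd : m ≤ d) (hm : 3 ≤ m)
    {A : Finset α} (hA : #A = d + 1) {L : Finset (Finset α)}
    (hL : IsLowerSet (L : Set (Finset α))) (hLA : ∀ C ∈ L, C ⊆ A) {x : α}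
    (hx : #(L.nonMemberSubfamily x) ≤ m - 1) :
    (#L : ℝ) - (m - 1) ≤ ∑ v ∈ A, gain (#(L.nonMemberSubfamily v) - (m - 1)) := by
  have hsplit := fun v => card_memberSubfamily_add_card_nonMemberSubfamily v L
  rcases le_or_gt #L (m - 1) with hN | hN
  · have h₁ : (#L : ℝ) ≤ m - 1 := by
      have : #L + 1 ≤ m := by omega
      have : (#L : ℝ) + 1 ≤ m := by exact_mod_cast this
      linarith
    have h₂ : 0 ≤ ∑ v ∈ A, gain (#(L.nonMemberSubfamily v) - (m - 1)) :=
      sum_nonneg fun v _ => gain_nonneg _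
    linarith
  obtain ⟨e, he⟩ : ∃ e, #L = m - 1 + e := ⟨#L - (m - 1), by omega⟩
  have hxs := hsplit x
  have hxle := memberSubfamily_card_le hL x
  have hLe : (#L : ℝ) - (m - 1) = e := by
    have : #L + 1 = m + e := by omega
    have : (#L : ℝ) + 1 = m + e := by exact_mod_cast this
    linarith
  rw [hLe]
  set M := L.biUnion id with hM
  have hMA : M ⊆ A := biUnion_subset.2 hLA
  have hxM : x ∈ M := by
    obtain ⟨G, hG⟩ := card_pos.1 (show 0 < #(L.memberSubfamily x) by omega)
    exact mem_biUnion.2 ⟨_, (mem_memberSubfamily.1 hG).1, mem_insert_self _ _⟩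
  have hcount := card_vertices_add_card_pairs_le hL hxM
  rw [← hM] at hcount
  have hMle := card_le_card hMA
  have hM1 : #(M.erase x) = #M - 1 := card_erase_of_mem hxM
  have hMpos : 1 ≤ #M := card_pos.2 ⟨x, hxM⟩
  -- the sum splits into the vertices outside `M` and those in `M`
  have hsum : ((d + 1 - #M : ℕ) : ℝ) * gain e + ∑ v ∈ M.erase x, gain (e - #(L.memberSubfamily v))
      ≤ ∑ v ∈ A, gain (#(L.nonMemberSubfamily v) - (m - 1)) := by
    rw [← sum_sdiff hMA]
    refine add_le_add (le_of_eq ?_) ?_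
    · rw [sum_congr rfl (g := fun _ => gain e), sum_const, card_sdiff_of_subset hMA, hA,
        nsmul_eq_mul]
      intro v hv
      have hv' := (mem_sdiff.1 hv).2
      have : #(L.memberSubfamily v) = 0 := by
        rw [card_eq_zero, eq_empty_iff_forall_notMem]
        intro G hG
        exact hv' (mem_biUnion.2 ⟨_, (mem_memberSubfamily.1 hG).1, mem_insert_self _ _⟩)
      have := hsplit v
      congr 1
      omega
    · rw [← sum_erase_add _ _ hxM]
      refine le_add_of_le_of_nonneg (sum_le_sum fun v _ => le_of_eq ?_) (gain_nonneg _)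
      have := hsplit v
      congr 1
      omega
  refine le_trans ?_ hsum
  have hrest : 0 ≤ ∑ v ∈ M.erase x, gain (e - #(L.memberSubfamily v)) :=
    sum_nonneg fun v _ => gain_nonneg _
  have hdeg : ∀ v, #(L.memberSubfamily v) ≤ 2 * 2 ^ #(pairNeighbours L x v) := fun v =>
    memberSubfamily_card_le_two_pow hL x v _ fun u hux huv h =>
      mem_filter.2 ⟨mem_erase.2 ⟨hux, mem_biUnion.2 ⟨_, h, by simp⟩⟩, huv, h⟩
  obtain ⟨c, hc⟩ : ∃ c, d + 1 - #M = c := ⟨_, rfl⟩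
  rw [hc]
  have hc2 : 2 ≤ c := by omega
  have hcR : (2 : ℝ) ≤ c := by exact_mod_cast hc2
  rcases le_or_gt 6 e with he6 | he6
  · have hv : ∀ v ∈ M.erase x, 1 - (#(pairNeighbours L x v) : ℝ) / 2
        ≤ gain (e - #(L.memberSubfamily v)) := by
      intro v _
      have h := hdeg v
      generalize #(pairNeighbours L x v) = k at h
      rcases k with _ | _ | k
      · refine le_trans ?_ (gain_mono (show 4 ≤ e - #(L.memberSubfamily v) by omega))
        rw [gain_four]; norm_num
      · refine le_trans ?_ (gain_mono (show 2 ≤ e - #(L.memberSubfamily v) by omega))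
        rw [gain_two]; norm_num
      · refine le_trans ?_ (gain_nonneg _)
        push_cast
        have : (0 : ℝ) ≤ k := by positivity
        linarith
    have h₁ := sum_le_sum hv
    rw [sum_sub_distrib, ← sum_div, sum_const, hM1, nsmul_eq_mul, mul_one] at h₁
    have h₂ := sum_card_pairNeighbours_le L x (M.erase x) (notMem_erase x M)
    have h₃ : (∑ v ∈ M.erase x, (#(pairNeighbours L x v) : ℝ)) ≤ 2 * #(pairsAvoiding L x) := by
      exact_mod_cast h₂
    have h₄ : (e : ℝ) + #(pairsAvoiding L x) ≤ c * 2 + (#M - 1 : ℕ) := by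
      have : e + #(pairsAvoiding L x) ≤ c * 2 + (#M - 1) := by omega
      exact_mod_cast this
    rw [gain_eq_two he6]
    linarith
  rcases le_or_gt 3 c with hc3 | hc3
  · have h₁ : (3 : ℝ) ≤ c := by exact_mod_cast hc3
    have h₂ := div_three_le_gain (k := e) (by omega)
    have h₃ : (3 : ℝ) * (e / 3) ≤ c * gain e := by gcongr
    linarith
  -- Equality in the vertex count excludes pairs avoiding `x`, so vertices other than `x` have
  -- degree at most 2.
  obtain rfl : c = 2 := by omega
  have hpairs : pairsAvoiding L x = ∅ := by rw [← card_eq_zero]; omega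
  have hnb : ∀ v ∈ M.erase x, #(pairNeighbours L x v) = 0 := by
    have := sum_card_pairNeighbours_le L x (M.erase x) (notMem_erase x M)
    rw [hpairs, card_empty, mul_zero, Nat.le_zero, sum_eq_zero_iff] at this
    exact this
  have hM2 : (2 : ℝ) ≤ #(M.erase x) := by
    have : 2 ≤ #(M.erase x) := by omega
    exact_mod_cast this
  have hlow : 2 * gain (e - 2) ≤ ∑ v ∈ M.erase x, gain (e - #(L.memberSubfamily v)) := by
    have h₁ : ∀ v ∈ M.erase x, gain (e - 2) ≤ gain (e - #(L.memberSubfamily v)) := by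
      intro v hv
      have := hdeg v
      rw [hnb v hv] at this
      exact gain_mono (by omega)
    have h₂ := card_nsmul_le_sum _ _ _ h₁
    rw [nsmul_eq_mul] at h₂
    have := mul_le_mul_of_nonneg_right hM2 (gain_nonneg (e - 2))
    linarith
  have he1 : 1 ≤ e := by omega
  interval_cases e
  · rw [gain_one]; norm_num; linarith
  -- For e = 2 the outside points earn only 3/2. The link of `x` is too small to reach every vertex,
  -- and an isolated `v` earns the missing 1/2.
  · obtain ⟨v, hv, hxv⟩ : ∃ v ∈ M.erase x, {v, x} ∉ L := by
      by_contra! hall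
      have hsub : insert ∅ ((M.erase x).image fun v => {v}) ⊆ L.memberSubfamily x := by
        intro G hG
        rw [mem_memberSubfamily]
        rcases mem_insert.1 hG with rfl | hG
        · obtain ⟨v, hv⟩ : (M.erase x).Nonempty := card_pos.1 (by omega)
          exact ⟨hL (show insert x ∅ ≤ ({v, x} : Finset α) by simp) (hall v hv), by simp⟩
        · obtain ⟨v, hv, rfl⟩ := mem_image.1 hG
          refine ⟨?_, by simpa using (mem_erase.1 hv).1.symm⟩
          rw [pair_comm]
          exact hall v hv
      have := card_le_card hsub
      rw [card_insert_of_notMem (by simp), card_image_of_injective _ singleton_injective] at this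
      omega
    have hdeg1 : #(L.memberSubfamily v) ≤ 1 := by
      rw [card_le_one_iff_subset_singleton]
      refine ⟨∅, fun G hG => ?_⟩
      obtain ⟨hG, hvG⟩ := mem_memberSubfamily.1 hG
      rw [mem_singleton, eq_empty_iff_forall_notMem]
      intro u hu
      have hvu : {v, u} ∈ L := by
        refine hL ?_ hG
        simp only [insert_subset_iff, singleton_subset_iff]
        exact ⟨mem_insert_self _ _, mem_insert_of_mem hu⟩
      have hux : u ≠ x := fun h => hxv (h ▸ hvu)
      have : u ∈ pairNeighbours L x v :=
        mem_filter.2 ⟨mem_erase.2 ⟨hux, mem_biUnion.2 ⟨_, hvu, by simp⟩⟩,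
          fun h => hvG (h ▸ hu), hvu⟩
      rw [card_eq_zero.1 (hnb v hv)] at this
      exact notMem_empty u this
    have h₁ := single_le_sum (f := fun v => gain (2 - #(L.memberSubfamily v)))
      (fun v _ => gain_nonneg _) hv
    have h₂ := gain_mono (show 1 ≤ 2 - #(L.memberSubfamily v) by omega)
    rw [gain_one] at h₂
    rw [gain_two]
    push_cast
    linarith
  · rw [gain_one] at hlow
    rw [gain_three]; push_cast; linarith
  · rw [gain_two] at hlow
    rw [gain_four]; push_cast; linarith
  · rw [gain_three] at hlow
    rw [gain_five]; push_cast; linarith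

end Gain

/-! ### The glued link of a vertex -/

theorem exists_ne_mem_of_isMountain {V : Type*} {K : Finset (Finset V)} (hK : IsMountain K) {F : Finset V}
    (hF : F ∈ K) (x : V) : ∃ v ∈ F, v ≠ x :=
  exists_mem_ne (hK.1 F hF) x

section GluedLink

variable {V : Type*} [DecidableEq V] {t : ℕ}

/-- The trace of the link of `x` in the copy of `V` belonging to the index `τ`. -/
def liftSet (τ : Fin (t + 1)) (x : V) (F : Finset V) : Finset ((Fin (t + 1) × V) ⊕ ℕ) :=
  (F.erase x).image fun v => Sum.inl (τ, v)

/-- The links of `x` in the set systems `B τ`, placed on disjoint copies of `V` and glued along the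
empty set, together with `f x` isolated vertices. -/
def gluedLink (B : Fin (t + 1) → Finset (Finset V)) (f : V → ℕ) (x : V) :
    Finset (Finset ((Fin (t + 1) × V) ⊕ ℕ)) :=
  insert ∅ ((univ.sigma fun τ => (B τ).filter (x ∈ ·)).image (fun p => liftSet p.1 x p.2) ∪
    (range (f x)).image fun i => {Sum.inr i})

variable {B : Fin (t + 1) → Finset (Finset V)} {f : V → ℕ} {x : V}

theorem mem_liftSet {τ : Fin (t + 1)} {F : Finset V} {a : (Fin (t + 1) × V) ⊕ ℕ} :
    a ∈ liftSet τ x F ↔ ∃ v, v ≠ x ∧ v ∈ F ∧ Sum.inl (τ, v) = a := by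
  simp [liftSet, and_assoc]

theorem inl_mem_liftSet {τ σ : Fin (t + 1)} {F : Finset V} {v : V} :
    Sum.inl (σ, v) ∈ liftSet τ x F ↔ σ = τ ∧ v ≠ x ∧ v ∈ F := by
  rw [mem_liftSet]
  constructor
  · rintro ⟨w, h₁, h₂, h⟩
    simp only [Sum.inl.injEq, Prod.mk.injEq] at h
    obtain ⟨rfl, rfl⟩ := h
    exact ⟨rfl, h₁, h₂⟩
  · rintro ⟨rfl, h₁, h₂⟩
    exact ⟨v, h₁, h₂, rfl⟩

theorem card_liftSet {τ : Fin (t + 1)} {F : Finset V} (hx : x ∈ F) :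
    #(liftSet τ x F) + 1 = #F := by
  rw [liftSet, card_image_of_injective, card_erase_add_one hx]
  intro v w h
  simpa using h

theorem mem_gluedLink {G : Finset ((Fin (t + 1) × V) ⊕ ℕ)} :
    G ∈ gluedLink B f x ↔ G = ∅ ∨ (∃ τ, ∃ F ∈ B τ, x ∈ F ∧ liftSet τ x F = G) ∨
      ∃ i < f x, {Sum.inr i} = G := by
  simp [gluedLink, and_assoc]

theorem liftSet_inj {τ σ : Fin (t + 1)} {F H : Finset V} (hF : ∃ v ∈ F, v ≠ x) (hxF : x ∈ F)
    (hxH : x ∈ H) (h : liftSet τ x F = liftSet σ x H) : τ = σ ∧ F = H := by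
  obtain ⟨v, hvF, hvx⟩ := hF
  have hv : Sum.inl (τ, v) ∈ liftSet σ x H := h ▸ inl_mem_liftSet.2 ⟨rfl, hvx, hvF⟩
  obtain rfl := (inl_mem_liftSet.1 hv).1
  refine ⟨rfl, ?_⟩
  ext w
  by_cases hw : w = x
  · simp [hw, hxF, hxH]
  · have := Finset.ext_iff.1 h (Sum.inl (τ, w))
    simpa [inl_mem_liftSet, hw] using this

/-- Members of mountains have a second element, so their traces are nonempty and determine both the
index and the set: nothing is identified in the gluing. -/
theorem sum_gluedLink {M : Type*} [AddCommMonoid M] (hB : ∀ τ, IsMountain (B τ))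
    (φ : Finset ((Fin (t + 1) × V) ⊕ ℕ) → M) :
    ∑ G ∈ gluedLink B f x, φ G = φ ∅ + (∑ τ, ∑ F ∈ (B τ).filter (x ∈ ·), φ (liftSet τ x F) +
      ∑ i ∈ range (f x), φ {Sum.inr i}) := by
  have hne : ∀ τ, ∀ F ∈ B τ, ∃ a, a ∈ liftSet τ x F ∧ ∃ v, a = Sum.inl (τ, v) := by
    intro τ F hF
    obtain ⟨v, hvF, hvx⟩ := exists_ne_mem_of_isMountain (hB τ) hF x
    exact ⟨Sum.inl (τ, v), inl_mem_liftSet.2 ⟨rfl, hvx, hvF⟩, v, rfl⟩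
  rw [gluedLink, sum_insert, sum_union, sum_image, sum_image, sum_sigma]
  · intro i _ j _ h
    simpa using h
  · rintro ⟨τ, F⟩ hF ⟨σ, H⟩ hH h
    simp only [coe_sigma, Set.mem_sigma_iff, mem_coe, mem_univ, mem_filter, true_and] at hF hH
    obtain ⟨rfl, rfl⟩ :=
      liftSet_inj (exists_ne_mem_of_isMountain (hB τ) hF.1 x) hF.2 hH.2 h
    rfl
  · rw [disjoint_left]
    intro G hG hG'
    obtain ⟨⟨τ, F⟩, hF, rfl⟩ := mem_image.1 hG
    obtain ⟨i, -, hi⟩ := mem_image.1 hG'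
    simp only [mem_sigma, mem_univ, mem_filter, true_and] at hF
    obtain ⟨a, ha, v, rfl⟩ := hne τ F hF.1
    rw [← hi] at ha
    simp at ha
  · intro h
    rcases mem_union.1 h with h | h
    · obtain ⟨⟨τ, F⟩, hF, h⟩ := mem_image.1 h
      simp only [mem_sigma, mem_univ, mem_filter, true_and] at hF
      obtain ⟨a, ha, -⟩ := hne τ F hF.1
      rw [show liftSet τ x F = ∅ from h] at ha
      simp at ha
    · obtain ⟨i, -, h⟩ := mem_image.1 h
      exact singleton_ne_empty _ h

theorem card_gluedLink (hB : ∀ τ, IsMountain (B τ)) :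
    #(gluedLink B f x) = 1 + (∑ τ, setDegree (B τ) x + f x) := by
  have := sum_gluedLink (f := f) (x := x) hB (fun _ => 1)
  simpa [setDegree] using this

theorem familyWeight_gluedLink (hB : ∀ τ, IsMountain (B τ)) :
    familyWeight recWeight (gluedLink B f x) =
      1 + (∑ τ, ∑ F ∈ (B τ).filter (x ∈ ·), 1 / (#F : ℝ) + f x / 2) := by
  rw [familyWeight, sum_gluedLink hB]
  congr 1
  · simp [recWeight]
  congr 1
  · refine sum_congr rfl fun τ _ => sum_congr rfl fun F hF => ?_
    rw [recWeight, ← card_liftSet (τ := τ) (mem_filter.1 hF).2]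
    push_cast
    rfl
  · norm_num [recWeight]
    ring

theorem isLowerSet_gluedLink (hB : ∀ τ, IsMountain (B τ)) :
    IsLowerSet (gluedLink B f x : Set (Finset ((Fin (t + 1) × V) ⊕ ℕ))) := by
  intro G H hHG hG
  rw [mem_coe, mem_gluedLink] at *
  rcases hG with rfl | ⟨τ, F, hF, hxF, rfl⟩ | ⟨i, hi, rfl⟩
  · exact Or.inl (subset_empty.1 hHG)
  · obtain ⟨S, hS, rfl⟩ := subset_image_iff.1 hHG
    rcases S.eq_empty_or_nonempty with rfl | hne
    · exact Or.inl (by simp)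
    have hxS : x ∉ S := fun h => (mem_erase.1 (hS h)).1 rfl
    refine Or.inr (Or.inl ⟨τ, insert x S, (hB τ).2 F hF _ ?_ ?_, mem_insert_self _ _, ?_⟩)
    · exact insert_subset hxF fun v hv => (mem_erase.1 (hS hv)).2
    · have := hne.card_pos
      rw [Set.mem_ofPred_eq, card_insert_of_notMem hxS]
      omega
    · rw [liftSet, erase_insert hxS]
  · rcases subset_singleton_iff.1 hHG with rfl | rfl
    · exact Or.inl rfl
    · exact Or.inr (Or.inr ⟨i, hi, rfl⟩)

end GluedLink

/-! ### Missing sets of a block and the weight inside it -/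

section Missing

variable {V : Type*} [DecidableEq V]

/-- The complements in `A` of those sets with at least two elements that do not belong to `K`. -/
def missing (K : Finset (Finset V)) (A : Finset V) : Finset (Finset V) :=
  A.powerset.filter fun C => 2 ≤ #(A \ C) ∧ A \ C ∉ K

theorem isLowerSet_missing {K : Finset (Finset V)} (hK : IsMountain K) (A : Finset V) :
    IsLowerSet (missing K A : Set (Finset V)) := by
  intro C D hDC hC
  rw [mem_coe, missing, mem_filter, mem_powerset] at *
  have hsub : A \ C ⊆ A \ D := sdiff_subset_sdiff le_rfl hDC
  exact ⟨hDC.trans hC.1, hC.2.1.trans (card_le_card hsub),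
    fun h => hC.2.2 (hK.2 _ h _ hsub hC.2.1)⟩

theorem subset_of_mem_missing {K : Finset (Finset V)} {A C : Finset V} (hC : C ∈ missing K A) :
    C ⊆ A := mem_powerset.1 (mem_filter.1 hC).1

/-- The members of `K` that contain `v` and are contained in `A`. -/
def starWithin (K : Finset (Finset V)) (A : Finset V) (v : V) : Finset (Finset V) :=
  K.filter fun F => v ∈ F ∧ F ⊆ A

/-- A subset of `A` through `v` is {v}, a member of `K`, or absent from `K`; in the last case its
complement is a member of `missing` avoiding `v`. -/
theorem sum_star_powerset {M : Type*} [AddCommMonoid M] {K : Finset (Finset V)} (hK : IsMountain K)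
    {A : Finset V} {v : V} (hv : v ∈ A) (φ : Finset V → M) :
    ∑ G ∈ (A.erase v).powerset, φ (insert v G) = φ {v} + (∑ F ∈ starWithin K A v, φ F +
      ∑ C ∈ (missing K A).nonMemberSubfamily v, φ (A \ C)) := by
  have hinj : ∀ C ∈ (missing K A).nonMemberSubfamily v, A \ (A \ C) = C := fun C hC =>
    Finset.sdiff_sdiff_eq_self (subset_of_mem_missing (mem_nonMemberSubfamily.1 hC).1)
  rw [← sum_image (f := φ) (g := fun C => A \ C) (s := (missing K A).nonMemberSubfamily v),
    ← sum_image (f := φ) (g := fun G => insert v G), ← sum_union, ← sum_insert]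
  · refine sum_congr ?_ fun _ _ => rfl
    ext F
    simp only [mem_image, mem_powerset, mem_insert, mem_union, starWithin, mem_filter,
      mem_nonMemberSubfamily, missing]
    constructor
    · rintro ⟨G, hG, rfl⟩
      have hGA : insert v G ⊆ A := insert_subset hv (hG.trans (erase_subset _ _))
      by_cases h0 : G = ∅
      · exact Or.inl (by simp [h0])
      by_cases hKG : insert v G ∈ K
      · exact Or.inr (Or.inl ⟨hKG, mem_insert_self _ _, hGA⟩)
      · refine Or.inr (Or.inr ⟨A \ insert v G, ⟨⟨sdiff_subset, ?_, ?_⟩, ?_⟩, ?_⟩)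
        · rw [Finset.sdiff_sdiff_eq_self hGA,
            card_insert_of_notMem fun h => (mem_erase.1 (hG h)).1 rfl]
          have := (nonempty_iff_ne_empty.2 h0).card_pos
          omega
        · rwa [Finset.sdiff_sdiff_eq_self hGA]
        · simp
        · exact Finset.sdiff_sdiff_eq_self hGA
    · rintro (rfl | ⟨-, hvF, hFA⟩ | ⟨C, ⟨⟨hCA, -, -⟩, hvC⟩, rfl⟩)
      · exact ⟨∅, by simp, by simp⟩
      · exact ⟨F.erase v, erase_subset_erase v hFA, insert_erase hvF⟩
      · have hvAC : v ∈ A \ C := mem_sdiff.2 ⟨hv, hvC⟩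
        exact ⟨(A \ C).erase v, erase_subset_erase v sdiff_subset, insert_erase hvAC⟩
  · intro h
    rcases mem_union.1 h with h | h
    · have : 2 ≤ #{v} := hK.1 _ (mem_filter.1 h).1
      simp at this
    · obtain ⟨C, hC, hCv⟩ := mem_image.1 h
      have := (mem_filter.1 (mem_nonMemberSubfamily.1 hC).1).2.1
      rw [show A \ C = {v} from hCv] at this
      simp at this
  · rw [disjoint_left]
    intro F hF hF'
    obtain ⟨C, hC, rfl⟩ := mem_image.1 hF'
    exact (mem_filter.1 (mem_nonMemberSubfamily.1 hC).1).2.2 (mem_filter.1 hF).1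
  · intro G hG H hH h
    have hG' : v ∉ G := fun h => (mem_erase.1 (mem_powerset.1 hG h)).1 rfl
    have hH' : v ∉ H := fun h => (mem_erase.1 (mem_powerset.1 hH h)).1 rfl
    rw [← erase_insert hG', ← erase_insert hH', show insert v G = insert v H from h]
  · intro C hC D hD h
    rw [← hinj C hC, ← hinj D hD, show A \ C = A \ D from h]

theorem card_starWithin_add {K : Finset (Finset V)} (hK : IsMountain K)
    {A : Finset V} {d : ℕ} (hA : #A = d + 1) {v : V} (hv : v ∈ A) :
    1 + (#(starWithin K A v) + #((missing K A).nonMemberSubfamily v)) = 2 ^ d := by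
  have h := sum_star_powerset hK hv (fun _ => 1)
  simp only [sum_const, smul_eq_mul, mul_one, card_powerset, card_erase_of_mem hv, hA] at h
  simpa using h.symm

/-- The weight that `v` obtains from the members of `K` inside `A`. -/
noncomputable def innerWeight (K : Finset (Finset V)) (A : Finset V) (v : V) : ℝ :=
  1 + ∑ F ∈ starWithin K A v, 1 / (#F : ℝ)

theorem innerWeight_le {K : Finset (Finset V)} (hK : IsMountain K)
    {A : Finset V} {d : ℕ} (hA : #A = d + 1) {v : V} (hv : v ∈ A) :
    innerWeight K A v ≤ (2 ^ (d + 1) - 1) / ((d : ℝ) + 1) -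
      #((missing K A).nonMemberSubfamily v) / ((d : ℝ) + 1) := by
  have h := sum_star_powerset hK hv (fun F => 1 / (#F : ℝ))
  have h₁ : ∑ G ∈ (A.erase v).powerset, 1 / (#(insert v G) : ℝ)
      = (2 ^ (d + 1) - 1) / ((d : ℝ) + 1) := by
    rw [← colexSum_recWeight_two_pow, show d = #(A.erase v) by rw [card_erase_of_mem hv]; omega,
      ← sum_powerset_eq_colexSum]
    refine sum_congr rfl fun G hG => ?_
    rw [card_insert_of_notMem fun h => (mem_erase.1 (mem_powerset.1 hG h)).1 rfl, recWeight]
    push_cast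
    rfl
  have h₂ : (#((missing K A).nonMemberSubfamily v) : ℝ) / ((d : ℝ) + 1)
      ≤ ∑ C ∈ (missing K A).nonMemberSubfamily v, 1 / (#(A \ C) : ℝ) := by
    have := card_nsmul_le_sum ((missing K A).nonMemberSubfamily v)
      (fun C => 1 / (#(A \ C) : ℝ)) (1 / ((d : ℝ) + 1)) ?_
    · rw [nsmul_eq_mul] at this
      linarith [this, mul_one_div (#((missing K A).nonMemberSubfamily v) : ℝ) ((d : ℝ) + 1)]
    · intro C hC
      have h2 := (mem_filter.1 (mem_nonMemberSubfamily.1 hC).1).2.1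
      have h3 : #(A \ C) ≤ d + 1 := hA ▸ card_le_card sdiff_subset
      have h4 : (0 : ℝ) < #(A \ C) := by exact_mod_cast (by omega : 0 < #(A \ C))
      have h5 : (#(A \ C) : ℝ) ≤ d + 1 := by exact_mod_cast h3
      exact one_div_le_one_div_of_le h4 h5
  rw [h₁] at h
  simp only [card_singleton, Nat.cast_one, div_one] at h
  unfold innerWeight
  linarith

theorem sum_innerWeight {K : Finset (Finset V)} (hK : IsMountain K)
    {A : Finset V} {d : ℕ} (hA : #A = d + 1) :
    ∑ v ∈ A, innerWeight K A v = 2 ^ (d + 1) - 1 - #(missing K A) := by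
  have h₁ : ∑ v ∈ A, ∑ F ∈ starWithin K A v, 1 / (#F : ℝ) = #(K.filter (· ⊆ A)) := by
    have : ∀ v ∈ A, ∑ F ∈ starWithin K A v, 1 / (#F : ℝ)
        = ∑ F ∈ K.filter (· ⊆ A), if v ∈ F then 1 / (#F : ℝ) else 0 := by
      intro v _
      rw [← sum_filter, filter_filter]
      refine sum_congr ?_ fun _ _ => rfl
      ext F
      simp [starWithin, and_comm]
    rw [sum_congr rfl this, sum_comm, card_eq_sum_ones, Nat.cast_sum]
    refine sum_congr rfl fun F hF => ?_
    obtain ⟨hFK, hFA⟩ := mem_filter.1 hF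
    have h2 : 2 ≤ #F := hK.1 F hFK
    rw [← sum_filter, filter_mem_eq_inter, inter_eq_right.2 hFA, sum_const, nsmul_eq_mul]
    have : (#F : ℝ) ≠ 0 := by exact_mod_cast (by omega : #F ≠ 0)
    field_simp
    simp
  have h₂ : #(K.filter (· ⊆ A)) + #(missing K A) + (d + 2) = 2 ^ (d + 1) := by
    have hm : #(missing K A) = #(A.powerset.filter fun F => 2 ≤ #F ∧ F ∉ K) := by
      refine card_bij' (fun C _ => A \ C) (fun F _ => A \ F) ?_ ?_ ?_ ?_
      · intro C hC
        exact mem_filter.2 ⟨mem_powerset.2 sdiff_subset, (mem_filter.1 hC).2⟩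
      · intro F hF
        obtain ⟨h₁, h₂⟩ := mem_filter.1 hF
        refine mem_filter.2 ⟨mem_powerset.2 sdiff_subset, ?_⟩
        rwa [Finset.sdiff_sdiff_eq_self (mem_powerset.1 h₁)]
      · intro C hC
        exact Finset.sdiff_sdiff_eq_self (subset_of_mem_missing hC)
      · intro F hF
        exact Finset.sdiff_sdiff_eq_self (mem_powerset.1 (mem_filter.1 hF).1)
    have hsmall : #(A.powerset.filter fun F => ¬ 2 ≤ #F) = d + 2 := by
      have : A.powerset.filter (fun F => ¬ 2 ≤ #F) = insert ∅ (A.image fun v => {v}) := by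
        ext F
        simp only [mem_filter, mem_powerset, mem_insert, mem_image]
        constructor
        · rintro ⟨hFA, hF⟩
          rcases F.eq_empty_or_nonempty with rfl | hne
          · exact Or.inl rfl
          · have := hne.card_pos
            obtain ⟨v, rfl⟩ := card_eq_one.1 (by omega : #F = 1)
            exact Or.inr ⟨v, by simpa using hFA, rfl⟩
        · rintro (rfl | ⟨v, hv, rfl⟩)
          · simp
          · simpa using hv
      rw [this, card_insert_of_notMem (by simp), card_image_of_injective _ singleton_injective, hA]
    have hin : #(K.filter (· ⊆ A)) = #(A.powerset.filter fun F => 2 ≤ #F ∧ F ∈ K) := by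
      congr 1
      ext F
      simp only [mem_filter, mem_powerset]
      exact ⟨fun h => ⟨h.2, hK.1 F h.1, h.1⟩, fun h => ⟨h.2.2, h.1⟩⟩
    have hp := card_filter_add_card_filter_not (s := A.powerset) (fun F => 2 ≤ #F)
    have hq := card_filter_add_card_filter_not (s := A.powerset.filter fun F => 2 ≤ #F)
      (fun F => F ∈ K)
    rw [filter_filter, filter_filter] at hq
    rw [card_powerset, hA] at hp
    omega
  have h₃ : (#(K.filter (· ⊆ A)) : ℝ) + #(missing K A) + (d + 2) = 2 ^ (d + 1) := by
    exact_mod_cast h₂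
  simp only [innerWeight, sum_add_distrib, h₁, sum_const, hA, nsmul_eq_mul]
  push_cast
  linarith

end Missing

/-! ### Structure around light vertices -/

/-- The vertices joined to `x` by a pair in `K`, and `x` itself. -/
def closedNbhd {V : Type*} [Fintype V] [DecidableEq V] (K : Finset (Finset V)) (x : V) :
    Finset V :=
  insert x (univ.filter fun v => v ≠ x ∧ {x, v} ∈ K)

theorem subset_closedNbhd {V : Type*} [Fintype V] [DecidableEq V]
    {K : Finset (Finset V)} (hK : IsMountain K) {F : Finset V} (hF : F ∈ K)
    {x : V} (hx : x ∈ F) : F ⊆ closedNbhd K x := by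
  intro v hv
  by_cases hvx : v = x
  · rw [hvx]; exact mem_insert_self _ _
  · refine mem_insert_of_mem (mem_filter.2 ⟨mem_univ _, hvx, hK.2 F hF _ ?_ ?_⟩)
    · exact insert_subset hx (singleton_subset_iff.2 hv)
    · exact (card_pair (Ne.symm hvx)).ge

section LightVertices

variable {V : Type*} [DecidableEq V] {t : ℕ}
  {B : Fin (t + 1) → Finset (Finset V)} {f : V → ℕ} {x : V}

theorem card_vertices_gluedLink_le {d m : ℕ} (hd : 4 ≤ d) (hmd : m ≤ d) (hm : 3 ≤ m)
    (hB : ∀ τ, IsMountain (B τ)) (hcard : 2 ^ d + 1 ≤ #(gluedLink B f x) + m)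
    (hlt : #(gluedLink B f x) < 2 ^ d)
    (hw : familyWeight recWeight (gluedLink B f x) < (2 ^ (d + 1) - (m : ℝ)) / ((d : ℝ) + 1)) :
    #((gluedLink B f x).biUnion id) ≤ d := by
  by_contra! h
  have h₁ := colexSum_add_le_familyWeight recWeight_antitone
    (isLowerSet_gluedLink (f := f) (x := x) hB) (d := d) (by omega) h
  have h₂ := colexSum_mono recWeight_nonneg
    (show 2 ^ d - m ≤ #(gluedLink B f x) - 1 by omega)
  have h₃ := colexSum_recWeight_slack hd hmd hm
  have h₄ : recWeight 1 = 1 / 2 := by norm_num [recWeight]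
  linarith

theorem card_gluedLink_lt {d m : ℕ} (hm : 3 ≤ m) (hB : ∀ τ, IsMountain (B τ))
    (hw : familyWeight recWeight (gluedLink B f x) < (2 ^ (d + 1) - (m : ℝ)) / ((d : ℝ) + 1)) :
    #(gluedLink B f x) < 2 ^ d := by
  by_contra! h
  have h₁ := colexSum_card_le_familyWeight recWeight_antitone
    (isLowerSet_gluedLink (f := f) (x := x) hB)
  have h₂ := colexSum_mono recWeight_nonneg h
  rw [colexSum_recWeight_two_pow] at h₂
  have h₃ : (2 ^ (d + 1) - (m : ℝ)) / ((d : ℝ) + 1) ≤ (2 ^ (d + 1) - 1) / ((d : ℝ) + 1) := by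
    have : (3 : ℝ) ≤ m := by exact_mod_cast hm
    gcongr
    linarith
  linarith

theorem two_pow_add_two_pow_le {p q : ℕ} (hp : 1 ≤ p) (hq : 1 ≤ q) :
    2 * (2 ^ p + 2 ^ q) ≤ 2 ^ (p + q) + 4 := by
  obtain ⟨p, rfl⟩ := Nat.exists_eq_add_of_le' hp
  obtain ⟨q, rfl⟩ := Nat.exists_eq_add_of_le' hq
  have h₁ := Nat.one_le_two_pow (n := p)
  have h₂ := Nat.one_le_two_pow (n := q)
  rw [show p + 1 + (q + 1) = p + q + 2 by ring, pow_succ, pow_succ, pow_succ, pow_succ, pow_add]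
  nlinarith

theorem two_mul_le_two_pow_pred {d : ℕ} (hd : 4 ≤ d) : 2 * d ≤ 2 ^ (d - 1) := by
  induction d, hd using Nat.le_induction with
  | base => norm_num
  | succ d hd ih =>
    rw [show d + 1 - 1 = d - 1 + 1 by omega, pow_succ]
    omega

/-- If the weight of `x` is small, then only the first set system contributes to it. -/
theorem vertices_gluedLink_eq_zero {d m : ℕ} (hd : 4 ≤ d) (hmd : m ≤ d)
    (hB : ∀ τ, IsMountain (B τ)) (hcard : 2 ^ d + 1 ≤ #(gluedLink B f x) + m)
    (hsmall : ∀ τ : Fin (t + 1), 0 < (τ : ℕ) → ∀ F ∈ B τ, #F < d)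
    (hP : #((gluedLink B f x).biUnion id) ≤ d) :
    #((gluedLink B f x).biUnion id) = d ∧
      ∀ a ∈ (gluedLink B f x).biUnion id, ∃ v, a = Sum.inl (0, v) := by
  classical
  set L := gluedLink B f x with hL
  set P := L.biUnion id
  have hLP : L ⊆ P.powerset := fun G hG => mem_powerset.2 fun a ha => mem_biUnion.2 ⟨G, hG, ha⟩
  have hpow := two_mul_le_two_pow_pred hd
  have hdd : 2 ^ d = 2 ^ (d - 1) * 2 := by rw [← pow_succ, Nat.sub_add_cancel (by omega)]
  have hPd : #P = d := by
    by_contra hne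
    have h₁ := card_le_card hLP
    have h₂ : 2 ^ #P ≤ 2 ^ (d - 1) := Nat.pow_le_pow_right (by norm_num) (by omega)
    rw [card_powerset] at h₁
    omega
  refine ⟨hPd, ?_⟩
  let q : (Fin (t + 1) × V) ⊕ ℕ → Prop := fun a => ∃ v, a = Sum.inl (0, v)
  have hq : ∀ G ∈ L, (∀ a ∈ G, q a) ∨ (∀ a ∈ G, ¬ q a) := by
    intro G hG
    rcases mem_gluedLink.1 hG with rfl | ⟨τ, F, hF, hxF, rfl⟩ | ⟨i, hi, rfl⟩
    · simp
    · by_cases hτ : τ = 0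
      · left
        intro a ha
        obtain ⟨v, -, -, rfl⟩ := mem_liftSet.1 ha
        exact ⟨v, by rw [hτ]⟩
      · right
        rintro a ha ⟨v, rfl⟩
        exact hτ (inl_mem_liftSet.1 ha).1.symm
    · right
      simp [q]
  -- Without vertices in copy 0, the size bound excludes `P` and its d subsets of size d - 1, more
  -- than the m - 1 sets that may be absent. A mixture splits `L` between two smaller cubes, which
  -- is also too few.
  by_cases h₀ : ∀ a ∈ P, ¬ q a
  · exfalso
    have hsize : ∀ G ∈ L, #G + 2 ≤ d := by
      intro G hG
      have hGP : G ⊆ P := mem_powerset.1 (hLP hG)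
      rcases mem_gluedLink.1 hG with rfl | ⟨τ, F, hF, hxF, rfl⟩ | ⟨i, hi, rfl⟩
      · simp; omega
      · have h₁ := card_liftSet (τ := τ) hxF
        obtain ⟨v, hvF, hvx⟩ := exists_ne_mem_of_isMountain (hB τ) hF x
        have hτ : τ ≠ 0 := by
          rintro rfl
          exact h₀ _ (hGP (inl_mem_liftSet.2 ⟨rfl, hvx, hvF⟩)) ⟨v, rfl⟩
        have h₂ := hsmall τ (Nat.pos_of_ne_zero fun h => hτ (Fin.ext h)) F hF
        omega
      · simp; omega
    have hsub : L ∪ insert P (powersetCard (d - 1) P) ⊆ P.powerset := by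
      refine union_subset hLP (insert_subset (by simp) fun G hG => ?_)
      exact mem_powerset.2 (mem_powersetCard.1 hG).1
    have hdisj : Disjoint L (insert P (powersetCard (d - 1) P)) := by
      rw [disjoint_left]
      intro G hG hG'
      have := hsize G hG
      rcases mem_insert.1 hG' with rfl | hG'
      · omega
      · have := (mem_powersetCard.1 hG').2
        omega
    have h₁ := card_le_card hsub
    have h₂ : P ∉ powersetCard (d - 1) P := fun h => by
      have := (mem_powersetCard.1 h).2
      omega
    rw [card_union_of_disjoint hdisj, card_insert_of_notMem h₂, card_powersetCard, card_powerset,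
      hPd] at h₁
    have h₃ : d.choose (d - 1) = d := by
      rw [Nat.choose_symm_of_eq_add (show d = d - 1 + 1 by omega), Nat.choose_one_right]
    omega
  · by_contra h₁
    push Not at h₀ h₁
    obtain ⟨a, ha, hqa⟩ := h₀
    obtain ⟨b, hb, hqb⟩ := h₁
    have hqb' : ¬ q b := fun ⟨v, hv⟩ => hqb v hv
    have hsub : L ⊆ (P.filter q).powerset ∪ (P.filter fun a => ¬ q a).powerset := by
      intro G hG
      have hGP : G ⊆ P := mem_powerset.1 (hLP hG)
      rcases hq G hG with h | h
      · exact mem_union_left _ (mem_powerset.2 fun a ha => mem_filter.2 ⟨hGP ha, h a ha⟩)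
      · exact mem_union_right _ (mem_powerset.2 fun a ha => mem_filter.2 ⟨hGP ha, h a ha⟩)
    have h₂ := (card_le_card hsub).trans (card_union_le _ _)
    rw [card_powerset, card_powerset] at h₂
    have h₃ := card_filter_add_card_filter_not (s := P) q
    have h₄ : 1 ≤ #(P.filter q) := card_pos.2 ⟨a, mem_filter.2 ⟨ha, hqa⟩⟩
    have h₅ : 1 ≤ #(P.filter fun a => ¬ q a) := card_pos.2 ⟨b, mem_filter.2 ⟨hb, hqb'⟩⟩
    have h₆ := two_pow_add_two_pow_le h₄ h₅
    rw [h₃, hPd] at h₆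
    omega

/-- The link of `x` lives on the d neighbours in `B 0` and has at least 2^d + 1 - m members, which
bounds the missing sets. If `A` were in `B 0`, the link would have 2^d members, too many for a light
vertex. -/
theorem light_vertex_structure [Fintype V] {d m : ℕ} (hd : 4 ≤ d) (hmd : m ≤ d) (hm : 3 ≤ m)
    (hB : ∀ τ, IsMountain (B τ)) (hcard : 2 ^ d + 1 ≤ #(gluedLink B f x) + m)
    (hsmall : ∀ τ : Fin (t + 1), 0 < (τ : ℕ) → ∀ F ∈ B τ, #F < d)
    (hw : familyWeight recWeight (gluedLink B f x) < (2 ^ (d + 1) - (m : ℝ)) / ((d : ℝ) + 1)) :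
    #(closedNbhd (B 0) x) = d + 1 ∧ closedNbhd (B 0) x ∉ B 0 ∧
      #((missing (B 0) (closedNbhd (B 0) x)).nonMemberSubfamily x) ≤ m - 1 := by
  have hlt := card_gluedLink_lt hm hB hw
  obtain ⟨hPd, hP⟩ := vertices_gluedLink_eq_zero hd hmd hB hcard hsmall
    (card_vertices_gluedLink_le hd hmd hm hB hcard hlt hw)
  set L := gluedLink B f x with hL
  set A := closedNbhd (B 0) x with hAdef
  have hxA : x ∈ A := mem_insert_self _ _
  have hstar : ∀ F ∈ B 0, x ∈ F → F ⊆ A := fun F hF hxF => subset_closedNbhd (hB 0) hF hxF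
  have hAcard : #A = d + 1 := by
    rw [hAdef, closedNbhd, card_insert_of_notMem (by simp), ← hPd]
    congr 1
    refine card_bij (fun v _ => Sum.inl (0, v)) ?_ ?_ ?_
    · intro v hv
      obtain ⟨-, hvx, hxv⟩ := mem_filter.1 hv
      refine mem_biUnion.2 ⟨liftSet 0 x {x, v}, mem_gluedLink.2 (Or.inr (Or.inl
        ⟨0, _, hxv, by simp, rfl⟩)), inl_mem_liftSet.2 ⟨rfl, hvx, by simp⟩⟩
    · intro v _ w _ h
      simpa using h
    · intro a ha
      obtain ⟨v, rfl⟩ := hP a ha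
      obtain ⟨G, hG, hvG⟩ := mem_biUnion.1 ha
      rcases mem_gluedLink.1 hG with rfl | ⟨τ, F, hF, hxF, rfl⟩ | ⟨i, hi, rfl⟩
      · simp at hvG
      · obtain ⟨rfl, hvx, hvF⟩ := inl_mem_liftSet.1 hvG
        have := hstar F hF hxF hvF
        exact ⟨v, (mem_insert.1 this).resolve_left hvx, rfl⟩
      · simp at hvG
  have hsub : L ⊆ insert ∅ ((starWithin (B 0) A x).image (liftSet 0 x)) := by
    intro G hG
    have hGP : ∀ a ∈ G, a ∈ L.biUnion id := fun a ha => mem_biUnion.2 ⟨G, hG, ha⟩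
    rcases mem_gluedLink.1 hG with rfl | ⟨τ, F, hF, hxF, rfl⟩ | ⟨i, hi, rfl⟩
    · exact mem_insert_self _ _
    · obtain ⟨v, hvF, hvx⟩ := exists_ne_mem_of_isMountain (hB τ) hF x
      obtain ⟨w, hw⟩ := hP _ (hGP _ (inl_mem_liftSet.2 ⟨rfl, hvx, hvF⟩))
      simp only [Sum.inl.injEq, Prod.mk.injEq] at hw
      obtain ⟨rfl, -⟩ := hw
      exact mem_insert_of_mem (mem_image.2 ⟨F, mem_filter.2 ⟨hF, hxF, hstar F hF hxF⟩, rfl⟩)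
    · obtain ⟨w, hw⟩ := hP _ (hGP (Sum.inr i) (by simp))
      simp at hw
  have h₁ := (card_le_card hsub).trans ((card_insert_le _ _).trans
    (Nat.succ_le_succ card_image_le))
  have h₂ := card_starWithin_add (hB 0) hAcard hxA
  refine ⟨hAcard, ?_, by omega⟩
  intro hAK
  have h₃ : #(starWithin (B 0) A x) ≤ setDegree (B 0) x := by
    refine card_le_card fun F hF => ?_
    obtain ⟨h₁, h₂, -⟩ := mem_filter.1 hF
    exact mem_filter.2 ⟨h₁, h₂⟩
  have h₄ := card_gluedLink (f := f) (x := x) hB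
  have h₅ := single_le_sum (f := fun τ => setDegree (B τ) x) (fun _ _ => Nat.zero_le _)
    (mem_univ (0 : Fin (t + 1)))
  have h₆ : (missing (B 0) A).nonMemberSubfamily x = ∅ := by
    rw [eq_empty_iff_forall_notMem]
    intro C hC
    obtain ⟨-, h₁, h₂⟩ := mem_filter.1 (mem_nonMemberSubfamily.1 hC).1
    exact h₂ ((hB 0).2 A hAK _ sdiff_subset h₁)
  rw [h₆, card_empty] at h₂
  rw [← hL] at h₄
  omega

/-- Missing sets inside `A` must be replaced by link members outside it to meet the degree
condition; by `familyWeight_inter_powerset_add_le` these weigh at least `gain`. -/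
theorem innerWeight_add_gain_le {d m : ℕ} (hB : ∀ τ, IsMountain (B τ))
    (hcard : 2 ^ d + 1 ≤ #(gluedLink B f x) + m)
    {A : Finset V} (hA : #A = d + 1) (hx : x ∈ A) :
    innerWeight (B 0) A x + gain (#((missing (B 0) A).nonMemberSubfamily x) - (m - 1)) ≤
      familyWeight recWeight (gluedLink B f x) := by
  set L := gluedLink B f x with hL
  set D : Finset ((Fin (t + 1) × V) ⊕ ℕ) := (A.erase x).image fun v => Sum.inl (0, v) with hD
  have hmemD : ∀ τ : Fin (t + 1), ∀ v, Sum.inl (τ, v) ∈ D ↔ τ = 0 ∧ v ≠ x ∧ v ∈ A := fun τ v =>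
    inl_mem_liftSet (x := x)
  have hfilter : L.filter (· ⊆ D) = insert ∅ ((starWithin (B 0) A x).image (liftSet 0 x)) := by
    ext G
    simp only [mem_filter, mem_insert, mem_image]
    constructor
    · rintro ⟨hG, hGD⟩
      rcases mem_gluedLink.1 hG with rfl | ⟨τ, F, hF, hxF, rfl⟩ | ⟨i, hi, rfl⟩
      · exact Or.inl rfl
      · obtain ⟨v, hvF, hvx⟩ := exists_ne_mem_of_isMountain (hB τ) hF x
        obtain rfl := ((hmemD τ v).1 (hGD (inl_mem_liftSet.2 ⟨rfl, hvx, hvF⟩))).1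
        refine Or.inr ⟨F, mem_filter.2 ⟨hF, hxF, fun w hw => ?_⟩, rfl⟩
        by_cases hwx : w = x
        · rw [hwx]; exact hx
        · exact ((hmemD 0 w).1 (hGD (inl_mem_liftSet.2 ⟨rfl, hwx, hw⟩))).2.2
      · have := hGD (mem_singleton_self (Sum.inr i))
        simp [hD] at this
    · rintro (rfl | ⟨F, hF, rfl⟩)
      · exact ⟨mem_gluedLink.2 (Or.inl rfl), by simp⟩
      · obtain ⟨hFK, hxF, hFA⟩ := mem_filter.1 hF
        exact ⟨mem_gluedLink.2 (Or.inr (Or.inl ⟨0, F, hFK, hxF, rfl⟩)),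
          image_subset_image (erase_subset_erase x hFA)⟩
  have hinj : Set.InjOn (liftSet (0 : Fin (t + 1)) x) (starWithin (B 0) A x) := by
    intro F hF H hH h
    obtain ⟨hFK, hxF, -⟩ := mem_filter.1 hF
    obtain ⟨-, hxH, -⟩ := mem_filter.1 hH
    exact (liftSet_inj (exists_ne_mem_of_isMountain (hB 0) hFK x) hxF hxH h).2
  have hempty : ∅ ∉ (starWithin (B 0) A x).image (liftSet (0 : Fin (t + 1)) x) := by
    intro h
    obtain ⟨F, hF, hF0⟩ := mem_image.1 h
    obtain ⟨hFK, hxF, -⟩ := mem_filter.1 hF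
    obtain ⟨v, hvF, hvx⟩ := exists_ne_mem_of_isMountain (hB 0) hFK x
    have : Sum.inl ((0 : Fin (t + 1)), v) ∈ liftSet 0 x F := inl_mem_liftSet.2 ⟨rfl, hvx, hvF⟩
    rw [hF0] at this
    simp at this
  have hc : #(L.filter (· ⊆ D)) = #(starWithin (B 0) A x) + 1 := by
    rw [hfilter, card_insert_of_notMem hempty, card_image_of_injOn hinj]
  have hw : familyWeight recWeight (L.filter (· ⊆ D)) = innerWeight (B 0) A x := by
    rw [hfilter, familyWeight, sum_insert hempty, sum_image hinj, innerWeight]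
    congr 1
    · simp [recWeight]
    · refine sum_congr rfl fun F hF => ?_
      rw [recWeight, ← card_liftSet (τ := (0 : Fin (t + 1))) (mem_filter.1 hF).2.1]
      push_cast
      rfl
  have h₁ := familyWeight_inter_powerset_add_le recWeight_antitone
    (isLowerSet_gluedLink (f := f) (x := x) hB) D
  rw [← hL, hw, hc] at h₁
  have h₂ := card_starWithin_add (hB 0) hA hx
  have h₃ := (gain_mono (show #((missing (B 0) A).nonMemberSubfamily x) - (m - 1)
    ≤ #L - (#(starWithin (B 0) A x) + 1) by omega)).trans (gain_le_colexSum _)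
  linarith

end LightVertices

theorem nine_mul_le_two_pow {d : ℕ} (hd : 6 ≤ d) : 9 * d ≤ 2 * 2 ^ (d - 1) := by
  induction d, hd using Nat.le_induction with
  | base => norm_num
  | succ d hd ih =>
    rw [show d + 1 - 1 = d - 1 + 1 by omega, pow_succ]
    omega

/-- Arithmetic for vertices in several blocks. One gain belongs to the share itself, the other is
reserved to cover the gain of a distinguished block. -/
theorem two_mul_gain_le {d m u : ℕ} (hd : 4 ≤ d) (hmd : m ≤ d) (hm : 3 ≤ m)
    (hu : u ≤ 2 * (m - 1)) :
    ((m : ℝ) - 1 - u) / (d + 1) + 2 * gain (u - (m - 1)) ≤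
      1 / 2 + ((2 : ℝ) ^ (d - 1) - m) / d := by
  have hmdR : (m : ℝ) ≤ d := by exact_mod_cast hmd
  have hdR : (4 : ℝ) ≤ d := by exact_mod_cast hd
  have hpow : (2 : ℝ) * d ≤ 2 ^ (d - 1) := by exact_mod_cast two_mul_le_two_pow_pred hd
  have hmono : ((2 : ℝ) ^ (d - 1) - d) / d ≤ ((2 : ℝ) ^ (d - 1) - m) / d := by gcongr
  rcases le_or_gt u (m - 1) with h | h
  · rw [Nat.sub_eq_zero_of_le h, gain_zero, mul_zero, add_zero]
    have h₁ : ((m : ℝ) - 1 - u) / (d + 1) ≤ 1 := by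
      rw [div_le_one (by positivity)]
      have : (0 : ℝ) ≤ u := by positivity
      linarith
    have h₂ : 1 ≤ ((2 : ℝ) ^ (d - 1) - d) / d := by
      rw [le_div_iff₀ (by positivity)]
      linarith
    linarith
  obtain ⟨k, rfl⟩ : ∃ k, u = m - 1 + k := ⟨u - (m - 1), by omega⟩
  have hk : ((m : ℝ) - 1 - ((m - 1 + k : ℕ) : ℝ)) = -k := by
    rw [Nat.cast_add, Nat.cast_sub (by omega)]
    push_cast
    ring
  rw [hk, Nat.add_sub_cancel_left]
  refine le_trans ?_ (add_le_add_right hmono _)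
  -- From d = 6 on, the crude bound `gain` ≤ 2 suffices, since 9d ≤ 2^d makes the right side at
  -- least 4.
  rcases lt_or_ge d 6 with hd6 | hd6
  · have hk1 : 1 ≤ k := by omega
    have hk4 : k ≤ d - 1 := by omega
    clear hk hu h hmono hmdR hdR hpow
    interval_cases d <;> interval_cases k <;>
      norm_num [gain_one, gain_two, gain_three, gain_four]
  · have h₁ : (9 : ℝ) * d ≤ 2 * 2 ^ (d - 1) := by exact_mod_cast nine_mul_le_two_pow hd6
    have h₂ : 7 / 2 ≤ ((2 : ℝ) ^ (d - 1) - d) / d := by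
      rw [le_div_iff₀ (by positivity)]
      linarith
    have h₃ := gain_le_two k
    have h₄ : -(k : ℝ) / (d + 1) ≤ 0 :=
      div_nonpos_of_nonpos_of_nonneg (by simp) (by positivity)
    linarith

/-! ### Blocks and their shares -/

section Blocks

variable {V : Type*} [DecidableEq V] {K : Finset (Finset V)} {A : Finset V} {x : V} {d m : ℕ}

/-- An absent pair would make all its supersets in `A` through `x` absent, at least 2^(d-2) ≥ d > m
- 1 of them. -/
theorem pair_mem_of_block (hd : 4 ≤ d) (hmd : m ≤ d) (hm : 3 ≤ m) (hK : IsMountain K)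
    (hA : #A = d + 1) (hx : #((missing K A).nonMemberSubfamily x) ≤ m - 1) {y z : V}
    (hy : y ∈ A) (hz : z ∈ A) (hyz : y ≠ z) : {y, z} ∈ K := by
  by_contra hnot
  have hsubA : {y, z} ⊆ A := insert_subset hy (singleton_subset_iff.2 hz)
  have hC : A \ {y, z} ∈ missing K A := by
    refine mem_filter.2 ⟨mem_powerset.2 sdiff_subset, ?_⟩
    rw [Finset.sdiff_sdiff_eq_self hsubA, card_pair hyz]
    exact ⟨le_rfl, hnot⟩
  have hsub : ((A \ {y, z}).erase x).powerset ⊆ (missing K A).nonMemberSubfamily x := by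
    intro C hC'
    rw [mem_powerset] at hC'
    exact mem_nonMemberSubfamily.2 ⟨isLowerSet_missing hK A (hC'.trans (erase_subset _ _)) hC,
      fun h => (mem_erase.1 (hC' h)).1 rfl⟩
  have h₁ := card_le_card hsub
  have h₂ : #(A \ {y, z}) = d - 1 := by
    rw [card_sdiff_of_subset hsubA, card_pair hyz, hA]
    omega
  have h₃ : d - 2 ≤ #((A \ {y, z}).erase x) := by
    have := pred_card_le_card_erase (s := A \ {y, z}) (a := x)
    omega
  have h₄ : 2 ^ (d - 2) ≤ 2 ^ #((A \ {y, z}).erase x) := Nat.pow_le_pow_right (by norm_num) h₃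
  have h₅ := two_mul_le_two_pow_pred hd
  rw [show d - 1 = d - 2 + 1 by omega, pow_succ] at h₅
  rw [card_powerset] at h₁
  omega

/-- At most m - 1 of the 2^(d-1) sets between {x, v} and `A` are absent. The pair weighs 1/2, and
every other member at least 1/d because `A` itself is not in `K`. -/
theorem pair_star_weight (hd : 4 ≤ d) (hmd : m ≤ d) (hm : 3 ≤ m) (hK : IsMountain K)
    (hA : #A = d + 1) (hAK : A ∉ K) (hx : #((missing K A).nonMemberSubfamily x) ≤ m - 1)
    (hxA : x ∈ A) {v : V} (hv : v ∈ A) (hvx : v ≠ x) :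
    1 / 2 + ((2 : ℝ) ^ (d - 1) - m) / d ≤ ∑ F ∈ K.filter (fun F => x ∈ F ∧ v ∈ F), 1 / (#F : ℝ) := by
  set S := (starWithin K A x).filter (v ∈ ·) with hS
  have hpair : {x, v} ∈ S := by
    refine mem_filter.2 ⟨mem_filter.2 ⟨pair_mem_of_block hd hmd hm hK hA hx hxA hv hvx.symm,
      by simp, insert_subset hxA (singleton_subset_iff.2 hv)⟩, by simp⟩
  have hScard : 2 ^ (d - 1) + 1 ≤ #S + m := by
    have h₁ := card_starWithin_add hK hA hxA
    have h₂ := card_starWithin_add hK (A := A.erase v) (d := d - 1)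
      (by rw [card_erase_of_mem hv]; omega) (mem_erase.2 ⟨hvx.symm, hxA⟩)
    have h₃ := card_filter_add_card_filter_not (s := starWithin K A x) (v ∈ ·)
    have h₄ : (starWithin K A x).filter (v ∉ ·) = starWithin K (A.erase v) x := by
      ext F
      simp only [starWithin, mem_filter, subset_erase]
      tauto
    have hdd : 2 ^ d = 2 ^ (d - 1) * 2 := by rw [← pow_succ, Nat.sub_add_cancel (by omega)]
    rw [h₄, ← hS] at h₃
    omega
  have hsub : S ⊆ K.filter (fun F => x ∈ F ∧ v ∈ F) := by
    intro F hF
    obtain ⟨h₁, h₂⟩ := mem_filter.1 hF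
    obtain ⟨h₃, h₄, -⟩ := mem_filter.1 h₁
    exact mem_filter.2 ⟨h₃, h₄, h₂⟩
  refine le_trans ?_ (sum_le_sum_of_subset_of_nonneg hsub fun F _ _ => by positivity)
  rw [← add_sum_erase _ _ hpair, card_pair hvx.symm]
  have h₁ : ∀ F ∈ S.erase {x, v}, 1 / (d : ℝ) ≤ 1 / (#F : ℝ) := by
    intro F hF
    obtain ⟨hFK, -, hFA⟩ := mem_filter.1 (mem_filter.1 (mem_erase.1 hF).2).1
    have h₂ : #F < d + 1 := hA ▸ card_lt_card (hFA.ssubset_of_ne fun h => hAK (h ▸ hFK))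
    have h₃ : 2 ≤ #F := hK.1 F hFK
    have h₄ : (0 : ℝ) < #F := by exact_mod_cast (by omega : 0 < #F)
    exact one_div_le_one_div_of_le h₄ (by exact_mod_cast (by omega : #F ≤ d))
  have h₂ := card_nsmul_le_sum _ _ _ h₁
  rw [card_erase_of_mem hpair, nsmul_eq_mul, mul_one_div] at h₂
  have h₃ : ((2 : ℝ) ^ (d - 1) - m) / d ≤ ((#S - 1 : ℕ) : ℝ) / d := by
    have : 2 ^ (d - 1) ≤ (#S - 1) + m := by omega
    have : (2 : ℝ) ^ (d - 1) ≤ ((#S - 1 : ℕ) : ℝ) + m := by exact_mod_cast this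
    gcongr
    linarith
  push_cast at *
  linarith

/-- The amount by which the weight of `v`, as far as it is determined by `A`, exceeds the average
that is to be proved. -/
noncomputable def share (K : Finset (Finset V)) (d m : ℕ) (A : Finset V) (v : V) : ℝ :=
  innerWeight K A v + gain (#((missing K A).nonMemberSubfamily v) - (m - 1)) -
    (2 ^ (d + 1) - (m : ℝ)) / ((d : ℝ) + 1)

theorem sum_share_nonneg {K : Finset (Finset V)} (hK : IsMountain K) {d m : ℕ}
    (hd : 4 ≤ d) (hmd : m ≤ d) (hm : 3 ≤ m) {A : Finset V} {x : V} (hA : #A = d + 1)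
    (hx : #((missing K A).nonMemberSubfamily x) ≤ m - 1) :
    0 ≤ ∑ v ∈ A, share K d m A v := by
  have h₁ := card_sub_le_sum_gain hd hmd hm hA (isLowerSet_missing hK A)
    (fun C hC => subset_of_mem_missing hC) hx
  have h₂ := sum_innerWeight hK hA
  simp only [share, sum_sub_distrib, sum_add_distrib, sum_const, hA, nsmul_eq_mul, h₂]
  push_cast
  rw [mul_div_cancel₀ _ (by positivity : (d : ℝ) + 1 ≠ 0)]
  linarith

theorem share_add_gain_le {K : Finset (Finset V)} (hK : IsMountain K) {d m : ℕ}
    (hd : 4 ≤ d) (hmd : m ≤ d) (hm : 3 ≤ m) {A : Finset V} {x v : V} (hA : #A = d + 1)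
    (hAK : A ∉ K) (hx : #((missing K A).nonMemberSubfamily x) ≤ m - 1) (hxA : x ∈ A)
    (hv : v ∈ A) (hvx : v ≠ x) :
    share K d m A v + gain (#((missing K A).nonMemberSubfamily v) - (m - 1)) ≤
      ∑ F ∈ K.filter (fun F => x ∈ F ∧ v ∈ F), 1 / (#F : ℝ) := by
  have h₁ := pair_star_weight hd hmd hm hK hA hAK hx hxA hv hvx
  have h₂ := innerWeight_le hK hA hv
  have h₃ := card_memberSubfamily_add_card_nonMemberSubfamily x (missing K A)
  have h₄ := card_memberSubfamily_add_card_nonMemberSubfamily v (missing K A)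
  have h₅ := memberSubfamily_card_le (isLowerSet_missing hK A) x
  have h₆ := two_mul_gain_le (u := #((missing K A).nonMemberSubfamily v)) hd hmd hm (by omega)
  have h₇ : ((m : ℝ) - 1 - #((missing K A).nonMemberSubfamily v)) / (d + 1)
      = (2 ^ (d + 1) - 1) / ((d : ℝ) + 1) - #((missing K A).nonMemberSubfamily v) / ((d : ℝ) + 1)
        - (2 ^ (d + 1) - (m : ℝ)) / ((d : ℝ) + 1) := by ring
  unfold share
  linarith

end Blocks

/-! ### Double counting over vertices and blocks -/

section Assembly

variable {V : Type*} [Fintype V] [DecidableEq V] {t : ℕ}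
  {B : Fin (t + 1) → Finset (Finset V)} {f : V → ℕ}

theorem sum_familyWeight_gluedLink (hB : ∀ τ, IsMountain (B τ)) :
    ∑ x, familyWeight recWeight (gluedLink B f x) =
      ∑ τ, (#(B τ) : ℝ) + ∑ x : V, ((f x : ℝ) / 2 + 1) := by
  have h : ∑ x : V, ∑ τ, ∑ F ∈ (B τ).filter (x ∈ ·), 1 / (#F : ℝ) = ∑ τ, (#(B τ) : ℝ) := by
    rw [sum_comm]
    refine sum_congr rfl fun τ _ => ?_
    simp only [sum_filter]
    rw [sum_comm, card_eq_sum_ones, Nat.cast_sum]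
    refine sum_congr rfl fun F hF => ?_
    have h2 : 2 ≤ #F := (hB τ).1 F hF
    have : (#F : ℝ) ≠ 0 := by exact_mod_cast (by omega : #F ≠ 0)
    rw [← sum_filter, filter_univ_mem, sum_const, nsmul_eq_mul]
    field_simp
    simp
  simp only [familyWeight_gluedLink hB, sum_add_distrib, h]
  ring

/-- All pairs inside a block belong to `K`, so a block through `y` lies in the closed neighbourhood
of `y`. Hence a light vertex lies in no block but its own. -/
theorem block_eq_closedNbhd {K : Finset (Finset V)} (hK : IsMountain K) {d m : ℕ}
    (hd : 4 ≤ d) (hmd : m ≤ d) (hm : 3 ≤ m) {A : Finset V} {x y : V} (hA : #A = d + 1)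
    (hx : #((missing K A).nonMemberSubfamily x) ≤ m - 1) (hy : y ∈ A)
    (hycard : #(closedNbhd K y) = d + 1) : A = closedNbhd K y := by
  refine eq_of_subset_of_card_le (fun z hz => ?_) (by omega)
  by_cases hzy : z = y
  · rw [hzy]; exact mem_insert_self _ _
  · exact mem_insert_of_mem (mem_filter.2 ⟨mem_univ _, hzy,
      pair_mem_of_block hd hmd hm hK hA hx hy hz (Ne.symm hzy)⟩)

/-- If every block `A` has a vertex `p A` whose closed neighbourhood it is, then the shares at `v` of
the blocks containing `v` are covered by the weight of `v`. -/
theorem sum_share_le {d m : ℕ} (hd : 4 ≤ d) (hmd : m ≤ d) (hm : 3 ≤ m)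
    (hB : ∀ τ, IsMountain (B τ)) {v : V} (hcard : 2 ^ d + 1 ≤ #(gluedLink B f v) + m)
    (𝒜 : Finset (Finset V)) (p : Finset V → V)
    (hp : ∀ A ∈ 𝒜, closedNbhd (B 0) (p A) = A ∧ #A = d + 1 ∧ A ∉ B 0 ∧
      #((missing (B 0) A).nonMemberSubfamily (p A)) ≤ m - 1)
    (hne : (𝒜.filter (v ∈ ·)).Nonempty) :
    ∑ A ∈ 𝒜.filter (v ∈ ·), share (B 0) d m A v ≤
      familyWeight recWeight (gluedLink B f v) - (2 ^ (d + 1) - (m : ℝ)) / ((d : ℝ) + 1) := by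
  set K := B 0
  have hK : IsMountain K := hB 0
  have hpA : ∀ A ∈ 𝒜, p A ∈ A := fun A hA => by
    have : p A ∈ closedNbhd K (p A) := mem_insert_self _ _
    rwa [(hp A hA).1] at this
  have huniq : ∀ A ∈ 𝒜, ∀ A' ∈ 𝒜, p A ∈ A' → A' = A := by
    intro A hA A' hA' h
    obtain ⟨h₁, h₂, -, -⟩ := hp A hA
    obtain ⟨-, h₃, -, h₄⟩ := hp A' hA'
    rw [block_eq_closedNbhd hK hd hmd hm h₃ h₄ h (by rw [h₁, h₂]), h₁]
  let gn : Finset V → ℝ := fun A => gain (#((missing K A).nonMemberSubfamily v) - (m - 1))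
  -- Only `A₀` uses the full inner weight at `v`. Its gain, being minimal, is covered by the spare
  -- gain of any other block, and the other blocks pay with sets through `v` and `p A`, which are
  -- not contained in `A₀`.
  obtain ⟨A₀, hA₀, hmin⟩ := exists_min_image (𝒜.filter (v ∈ ·)) gn hne
  obtain ⟨hA₀𝒜, hvA₀⟩ := mem_filter.1 hA₀
  set R := (𝒜.filter (v ∈ ·)).erase A₀ with hR
  rw [← add_sum_erase _ _ hA₀, ← hR]
  rcases R.eq_empty_or_nonempty with hR0 | ⟨A₁, hA₁⟩
  · rw [hR0, sum_empty, add_zero, share]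
    linarith [innerWeight_add_gain_le hB hcard (hp A₀ hA₀𝒜).2.1 hvA₀]
  have hRmem : ∀ A ∈ R, A ≠ A₀ ∧ A ∈ 𝒜 ∧ v ∈ A := fun A hA =>
    ⟨(mem_erase.1 hA).1, mem_filter.1 (mem_erase.1 hA).2⟩
  have hpairs : ∀ A ∈ R, share K d m A v + gn A ≤
      ∑ F ∈ K.filter (fun F => p A ∈ F ∧ v ∈ F), 1 / (#F : ℝ) := by
    intro A hA
    obtain ⟨hne, hA𝒜, hvA⟩ := hRmem A hA
    obtain ⟨-, h₂, h₃, h₄⟩ := hp A hA𝒜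
    refine share_add_gain_le hK hd hmd hm h₂ h₃ h₄ (hpA A hA𝒜) hvA fun h => ?_
    exact hne (huniq A hA𝒜 A₀ hA₀𝒜 (h ▸ hvA₀)).symm
  have hgain : gn A₀ ≤ ∑ A ∈ R, gn A :=
    (hmin A₁ (mem_erase.1 hA₁).2).trans
      (single_le_sum (f := gn) (fun A _ => gain_nonneg _) hA₁)
  have hdisj : (R : Set (Finset V)).PairwiseDisjoint
      fun A => K.filter (fun F => p A ∈ F ∧ v ∈ F) := by
    intro A hA A' hA' hne
    rw [Function.onFun, disjoint_left]
    intro F hF hF'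
    obtain ⟨hFK, hAF, -⟩ := mem_filter.1 hF
    obtain ⟨-, hAF', -⟩ := mem_filter.1 hF'
    have hsub := subset_closedNbhd hK hFK hAF
    rw [(hp A (hRmem A hA).2.1).1] at hsub
    exact hne (huniq A' (hRmem A' hA').2.1 A (hRmem A hA).2.1 (hsub hAF'))
  have hdisj' : Disjoint (starWithin K A₀ v)
      (R.biUnion fun A => K.filter (fun F => p A ∈ F ∧ v ∈ F)) := by
    rw [disjoint_left]
    intro F hF hF'
    obtain ⟨A, hA, hFA⟩ := mem_biUnion.1 hF'
    obtain ⟨hne, hA𝒜, -⟩ := hRmem A hA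
    exact hne (huniq A hA𝒜 A₀ hA₀𝒜 ((mem_filter.1 hF).2.2 (mem_filter.1 hFA).2.1)).symm
  have hsub : starWithin K A₀ v ∪ (R.biUnion fun A => K.filter (fun F => p A ∈ F ∧ v ∈ F))
      ⊆ K.filter (v ∈ ·) := by
    intro F hF
    rcases mem_union.1 hF with hF | hF
    · obtain ⟨h₁, h₂, -⟩ := mem_filter.1 hF
      exact mem_filter.2 ⟨h₁, h₂⟩
    · obtain ⟨A, -, hF⟩ := mem_biUnion.1 hF
      obtain ⟨h₁, -, h₂⟩ := mem_filter.1 hF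
      exact mem_filter.2 ⟨h₁, h₂⟩
  have h₁ := sum_le_sum_of_subset_of_nonneg (f := fun F => 1 / (#F : ℝ)) hsub
    fun F _ _ => by positivity
  rw [sum_union hdisj', sum_biUnion hdisj] at h₁
  have h₂ := sum_le_sum hpairs
  rw [sum_add_distrib] at h₂
  have h₃ := single_le_sum (f := fun τ => ∑ F ∈ (B τ).filter (v ∈ ·), 1 / (#F : ℝ))
    (fun τ _ => sum_nonneg fun F _ => by positivity) (mem_univ (0 : Fin (t + 1)))
  have h₄ : (0 : ℝ) ≤ f v / 2 := by positivity
  rw [familyWeight_gluedLink hB]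
  have h₅ : share K d m A₀ v = 1 + ∑ F ∈ starWithin K A₀ v, 1 / (#F : ℝ) + gn A₀ -
    (2 ^ (d + 1) - (m : ℝ)) / ((d : ℝ) + 1) := rfl
  rw [h₅]
  linarith

theorem card_mul_le_of_mountains {d m : ℕ} (hd : 4 ≤ d) (hmd : m ≤ d) (hm : 3 ≤ m)
    (hB : ∀ τ, IsMountain (B τ))
    (hdeg : ∀ x : V, (2 : ℤ) ^ d - (m : ℤ) ≤ (f x : ℤ) + ∑ τ, (setDegree (B τ) x : ℤ))
    (hsmall : ∀ τ : Fin (t + 1), 0 < (τ : ℕ) → ∀ F ∈ B τ, F.card < d) :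
    ((2 : ℝ) ^ (d + 1) - (m : ℝ)) / ((d : ℝ) + 1) * (Fintype.card V : ℝ) ≤
      ∑ τ, ((B τ).card : ℝ) + ∑ x : V, ((f x : ℝ) / 2 + 1) := by
  rcases isEmpty_or_nonempty V with hV | hV
  · rw [Fintype.card_eq_zero, Nat.cast_zero, mul_zero]
    positivity
  have hcard : ∀ x, 2 ^ d + 1 ≤ #(gluedLink B f x) + m := by
    intro x
    rw [card_gluedLink hB]
    have h := hdeg x
    have h' : (2 : ℤ) ^ d ≤ ((f x + ∑ τ, setDegree (B τ) x + m : ℕ) : ℤ) := by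
      push_cast
      linarith
    have h'' : 2 ^ d ≤ f x + ∑ τ, setDegree (B τ) x + m := by exact_mod_cast h'
    omega
  set T : ℝ := ((2 : ℝ) ^ (d + 1) - (m : ℝ)) / ((d : ℝ) + 1) with hT
  set X : Finset V := univ.filter fun x => familyWeight recWeight (gluedLink B f x) < T with hX
  -- Light vertices with the same closed neighbourhood yield a single block, counted once.
  set 𝒜 : Finset (Finset V) := X.image (closedNbhd (B 0))
  have hex : ∀ A : Finset V, ∃ x, A ∈ 𝒜 → x ∈ X ∧ closedNbhd (B 0) x = A := by
    intro A
    by_cases hA : A ∈ 𝒜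
    · obtain ⟨x, hx, h⟩ := mem_image.1 hA
      exact ⟨x, fun _ => ⟨hx, h⟩⟩
    · exact ⟨Classical.arbitrary V, fun h => absurd h hA⟩
  choose p hp using hex
  have hp' : ∀ A ∈ 𝒜, closedNbhd (B 0) (p A) = A ∧ #A = d + 1 ∧ A ∉ B 0 ∧
      #((missing (B 0) A).nonMemberSubfamily (p A)) ≤ m - 1 := by
    intro A hA
    obtain ⟨h₁, h₂⟩ := hp A hA
    have h₃ := light_vertex_structure hd hmd hm hB (hcard (p A)) hsmall (mem_filter.1 h₁).2
    rw [h₂] at h₃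
    exact ⟨h₂, h₃⟩
  have hvertex : ∀ v, ∑ A ∈ 𝒜.filter (v ∈ ·), share (B 0) d m A v ≤
      familyWeight recWeight (gluedLink B f v) - T := by
    intro v
    rcases (𝒜.filter (v ∈ ·)).eq_empty_or_nonempty with h | h
    · rw [h, sum_empty, sub_nonneg]
      by_contra! hlt
      have : closedNbhd (B 0) v ∈ 𝒜.filter (v ∈ ·) :=
        mem_filter.2 ⟨mem_image_of_mem _ (mem_filter.2 ⟨mem_univ _, hlt⟩), mem_insert_self _ _⟩
      rw [h] at this
      exact notMem_empty _ this
    · exact sum_share_le hd hmd hm hB (hcard v) 𝒜 p hp' h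
  have hsum : 0 ≤ ∑ v, ∑ A ∈ 𝒜.filter (v ∈ ·), share (B 0) d m A v := by
    simp only [sum_filter]
    rw [sum_comm]
    refine sum_nonneg fun A hA => ?_
    rw [← sum_filter, filter_univ_mem]
    obtain ⟨-, h₁, -, h₂⟩ := hp' A hA
    exact sum_share_nonneg (hB 0) hd hmd hm h₁ h₂
  have h₁ := hsum.trans (sum_le_sum fun v _ => hvertex v)
  rw [sum_sub_distrib, sum_familyWeight_gluedLink hB, sum_const, nsmul_eq_mul, card_univ] at h₁
  linarith

end Assembly

theorem mainTheorem2 {V : Type*} [Fintype V] [DecidableEq V] (d m t : ℕ)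
    (hd : 4 ≤ d) (hmd : m ≤ d) (hm : 3 ≤ m)
    (B : Fin t → Finset (Finset V)) (hB : ∀ τ, IsMountain (B τ))
    (f : V → ℕ)
    (hdeg : ∀ x : V, (2 : ℤ) ^ d - (m : ℤ) ≤ (f x : ℤ) + ∑ τ, (setDegree (B τ) x : ℤ))
    -- the family of index `0` is the first one; all later ones have only sets of size `< d`
    (hsmall : ∀ τ : Fin t, 0 < (τ : ℕ) → ∀ F ∈ B τ, F.card < d) :
    ((2 : ℝ) ^ (d + 1) - (m : ℝ)) / ((d : ℝ) + 1) * (Fintype.card V : ℝ) ≤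
      ∑ τ, ((B τ).card : ℝ) + ∑ x : V, ((f x : ℝ) / 2 + 1) := by
  cases t with
  | zero =>
    -- With no mountains at all, an empty one serves as the first.
    have h := card_mul_le_of_mountains (t := 0) (B := fun _ => (∅ : Finset (Finset V))) (f := f)
      hd hmd hm (fun _ => ⟨by simp, by simp⟩)
      (fun x => by simpa [setDegree] using hdeg x) (by simp)
    simpa using h
  | succ t => exact card_mul_le_of_mountains hd hmd hm hB hdeg hsmall
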